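/- Let $\mathbf k$ be a field of characteristic zero and $V$ a $\mathbf k$-vector space. A *rooted tree* is a finite tree with a distinguished vertex (the root), all edges being oriented towards the root; the *arity* of a vertex is the number of its incoming edges. Let $\mathrm{Tr}_n$ be the set of rooted trees with vertices numbered $1,\dots,n$, and $\mathrm{Tr}^1_n$ the set of rooted trees with $n$ vertices numbered $1,\dots,n$ and one additional, *special*, vertex $\circ$. The symmetric group $\Sigma_n$ acts on both by relabelling. Put $$\mathrm{Tr}(V)=\bigoplus_{n\ge 1}\mathrm{Span}_{\mathbf k}(\mathrm{Tr}_n)\otimes_{\Sigma_n}V^{\otimes n},\qquad \mathrm{Tr}^1(V)=\bigoplus_{n\ge 0}\mathrm{Span}_{\mathbf k}(\mathrm{Tr}^1_n)\otimes_{\Sigma_n}V^{\otimes n},$$ the spaces of rooted trees (respectively, rooted trees with one special vertex) whose (nonspecial) vertices are decorated by elements of $V$. An edge $e$ of $S\in\mathrm{Tr}^1_n$ is *special* if it is adjacent to $\circ$; then $S/e\in\mathrm{Tr}_n$ denotes the tree obtained by contracting $e$ to a vertex labelled by the endpoint of $e$ different from $\circ$. A *blow-up* of $T\in\mathrm{Tr}_n$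 is a pair $(S,e)$ of $S\in\mathrm{Tr}^1_n$ and a special edge $e$ of $S$ such that $S/e=T$ and $\circ$ has arity at least $2$ in $S$. Let $\mathrm{bl}(T)$ be the set of blow-ups of $T$, and let $\epsilon_{(S,e)}=+1$ if $e$ is an incoming edge of $\circ$ and $\epsilon_{(S,e)}=-1$ if $e$ is the outgoing edge of $\circ$. Let $\delta:\mathrm{Tr}(V)\to\mathrm{Tr}^1(V)$ be the linear map given, with the decorations carried along, by $$\delta(T)=\sum_{(S,e)\in \mathrm{bl}(T)}\epsilon_{(S,e)}\,S .$$ Finally, for decorated rooted trees $T,S$ let $T\star S\in\mathrm{Tr}(V)$ be the sum, over all vertices $a$ of $T$, of the trees obtained by joining the root of $S$ to $a$ by a new edge (the root being that of $T$), extended bilinearly. **Corollary.** There is an isomorphism of vector spaces, natural in $V$, $$\Phi_V:\ \mathsf L(V)\ \xrightarrow{\ \cong\ }\ \mathrm{Ker}\bigl(\delta:\mathrm{Tr}(V)\to\mathrm{Tr}^1(V)\bigr)$$ from the free Lie algebra $\mathsf L(V)$ on the vector space $V$. It sends each $v\in V$ to the one-vertex tree decorated by $v$, and it takes the Lie bracket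 to the commutator of $\star$, that is, $\Phi_V([x,y])=\Phi_V(x)\star\Phi_V(y)-\Phi_V(y)\star\Phi_V(x)$ for all $x,y\in\mathsf L(V)$. -/

import Mathlib

open scoped TensorProduct DirectSum

universe u v

noncomputable section

namespace LieTrees

/-! ### Rooted trees on a given vertex set -/

/-- A rooted tree with vertex set `α`, all edges being oriented towards the root: every vertex
other than the root has exactly one outgoing edge, which goes to `parent x`, and following the
outgoing edges leads from every vertex to the root. By convention `parent root = root` (this is not
an edge). -/
@[ext]
structure RTree (α : Type*) where
  root : α
  parent : α → α
  parent_root : parent root = root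
  reaches_root : ∀ x, ∃ m : ℕ, parent^[m] x = root

namespace RTree

variable {α β γ : Type*}

/-- `T.Edge a b`: there is an edge of `T` between `a` and `b`, oriented from `a` to `b`. -/
def Edge (T : RTree α) (a b : α) : Prop := a ≠ b ∧ T.parent a = b

/-- The arity of a vertex: the number of its incoming edges. -/
def arity (T : RTree α) (b : α) : ℕ := Set.ncard {a | T.Edge a b}

/-- Renaming the vertices of a tree along a bijection. -/
@[simps]
def relabel (e : α ≃ β) (T : RTree α) : RTree β where
  root := e T.root
  parent b := e (T.parent (e.symm b))
  parent_root := by simp [T.parent_root]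
  reaches_root b := by
    obtain ⟨m, hm⟩ := T.reaches_root (e.symm b)
    refine ⟨m, ?_⟩
    have key : ∀ (j : ℕ) (x : α),
        (fun b => e (T.parent (e.symm b)))^[j] (e x) = e (T.parent^[j] x) := by
      intro j
      induction j with
      | zero => intro x; rfl
      | succ j ih => intro x; simp [Function.iterate_succ_apply, ih]
    have := key m (e.symm b)
    rw [Equiv.apply_symm_apply] at this
    rw [this, hm]

@[simp] theorem relabel_refl (T : RTree α) : T.relabel (Equiv.refl α) = T := by
  ext <;> simp

theorem relabel_relabel (e : α ≃ β) (f : β ≃ γ) (T : RTree α) :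
    (T.relabel e).relabel f = T.relabel (e.trans f) := by
  ext <;> simp

/-- Renaming of vertices as a bijection between sets of trees. -/
def relabelEquiv (e : α ≃ β) : RTree α ≃ RTree β where
  toFun := relabel e
  invFun := relabel e.symm
  left_inv T := by simp [relabel_relabel]
  right_inv T := by simp [relabel_relabel]

@[simp] theorem edge_relabel (e : α ≃ β) (T : RTree α) (a b : α) :
    (T.relabel e).Edge (e a) (e b) ↔ T.Edge a b := by
  simp [Edge]

theorem arity_relabel (e : α ≃ β) (T : RTree α) (b : α) :
    (T.relabel e).arity (e b) = T.arity b := by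
  unfold arity
  rw [← Set.ncard_image_of_injective _ e.injective]
  congr 1
  ext c
  obtain ⟨a, rfl⟩ := e.surjective c
  simp

instance [Finite α] : Finite (RTree α) :=
  Finite.of_injective (fun T : RTree α => (T.root, T.parent)) (by
    intro S T h
    simp only [Prod.mk.injEq] at h
    exact RTree.ext h.1 h.2)

instance [Finite α] : Fintype (RTree α) := Fintype.ofFinite _

/-- The symmetric group acts on trees by relabelling the vertices. -/
instance : MulAction (Equiv.Perm α) (RTree α) where
  smul σ T := T.relabel σ
  one_smul T := relabel_refl T
  mul_smul σ τ T := (relabel_relabel τ σ T).symm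

/-! Trees with one additional *special* vertex are trees with vertex set `Option α`, the special
vertex being `none`. -/

/-- The symmetric group acts on trees with a special vertex by relabelling the other vertices. -/
instance : MulAction (Equiv.Perm α) (RTree (Option α)) where
  smul σ T := T.relabel (Equiv.optionCongr σ)
  one_smul T := by
    change T.relabel (Equiv.optionCongr (Equiv.refl α)) = T
    simp
  mul_smul σ τ T := by
    change T.relabel (Equiv.optionCongr (τ.trans σ)) = (T.relabel _).relabel _
    rw [relabel_relabel, Equiv.optionCongr_trans]

theorem smul_def (σ : Equiv.Perm α) (T : RTree α) : σ • T = T.relabel σ := rfl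

theorem smul_def_option (σ : Equiv.Perm α) (S : RTree (Option α)) :
    σ • S = S.relabel (Equiv.optionCongr σ) := rfl

/-- The one-vertex tree. -/
def single (α : Type*) [Unique α] : RTree α where
  root := default
  parent x := x
  parent_root := rfl
  reaches_root _ := ⟨0, Subsingleton.elim _ _⟩

/-! ### Blow-ups -/

/-- There is a (necessarily unique) special edge of `S`, that is, an edge adjacent to the special
vertex, whose other endpoint is `x`. Special edges will be denoted by their endpoint `x`. -/
def IsSpecialEdge (S : RTree (Option α)) (x : α) : Prop :=
  S.Edge (some x) none ∨ S.Edge none (some x)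

/-- The map of vertices which merges the special vertex with the vertex `x`; the resulting vertex
carries the label `x`. -/
def collapse (x : α) (o : Option α) : α := o.getD x

/-- `T` is the quotient `S/e` obtained by contracting the special edge `e` of `S` whose nonspecial
endpoint is `x`. -/
def IsContraction (S : RTree (Option α)) (x : α) (T : RTree α) : Prop :=
  T.root = collapse x S.root ∧
    ∀ a b, T.Edge a b ↔ a ≠ b ∧ ∃ a' b', S.Edge a' b' ∧ collapse x a' = a ∧ collapse x b' = b

/-- The set of blow-ups of `T`: pairs of a tree `S` with a special vertex of arity at least `2` and
a special edge of `S` such that the contraction of this edge gives `T`. -/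
def blowUps (T : RTree α) : Set (RTree (Option α) × α) :=
  {p | IsSpecialEdge p.1 p.2 ∧ IsContraction p.1 p.2 T ∧ 2 ≤ p.1.arity none}

open Classical in
/-- The sign of a blow-up: `+1` if the special edge is an incoming edge of the special vertex and
`-1` if it is its outgoing edge. -/
def sign (p : RTree (Option α) × α) : ℤ := if p.1.Edge (some p.2) none then 1 else -1

theorem collapse_optionCongr (e : α ≃ β) (x : α) (o : Option α) :
    collapse (e x) (Equiv.optionCongr e o) = e (collapse x o) := by
  cases o <;> rfl

theorem edge_relabel_option (e : α ≃ β) (S : RTree (Option α)) (x : α) :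
    ((S.relabel (Equiv.optionCongr e)).Edge (some (e x)) none ↔ S.Edge (some x) none) ∧
      ((S.relabel (Equiv.optionCongr e)).Edge none (some (e x)) ↔ S.Edge none (some x)) :=
  ⟨edge_relabel (Equiv.optionCongr e) S (some x) none,
    edge_relabel (Equiv.optionCongr e) S none (some x)⟩

theorem isContraction_relabel (e : α ≃ β) (S : RTree (Option α)) (x : α) (T : RTree α) :
    IsContraction (S.relabel (Equiv.optionCongr e)) (e x) (T.relabel e) ↔ IsContraction S x T := by
  unfold IsContraction
  refine and_congr ?_ ?_
  · simp only [relabel_root, collapse_optionCongr, e.apply_eq_iff_eq]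
  · rw [e.forall_congr_left]
    refine forall_congr' fun a => ?_
    obtain ⟨a, rfl⟩ := e.surjective a
    rw [e.forall_congr_left]
    refine forall_congr' fun b => ?_
    obtain ⟨b, rfl⟩ := e.surjective b
    rw [e.symm_apply_apply, e.symm_apply_apply, edge_relabel, Ne, e.apply_eq_iff_eq]
    have : (∃ a' b', (S.relabel (Equiv.optionCongr e)).Edge a' b' ∧
          collapse (e x) a' = e a ∧ collapse (e x) b' = e b) ↔
        ∃ a' b', S.Edge a' b' ∧ collapse x a' = a ∧ collapse x b' = b := by
      constructor
      · rintro ⟨a', b', h, h1, h2⟩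
        obtain ⟨a', rfl⟩ := (Equiv.optionCongr e).surjective a'
        obtain ⟨b', rfl⟩ := (Equiv.optionCongr e).surjective b'
        rw [collapse_optionCongr, e.apply_eq_iff_eq] at h1 h2
        exact ⟨a', b', (edge_relabel _ _ _ _).1 h, h1, h2⟩
      · rintro ⟨a', b', h, rfl, rfl⟩
        exact ⟨_, _, (edge_relabel _ _ _ _).2 h, collapse_optionCongr e x a',
          collapse_optionCongr e x b'⟩
    rw [this]

theorem mem_blowUps_relabel (e : α ≃ β) (S : RTree (Option α)) (x : α) (T : RTree α) :
    (S.relabel (Equiv.optionCongr e), e x) ∈ blowUps (T.relabel e) ↔ (S, x) ∈ blowUps T := by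
  have h : (S.relabel (Equiv.optionCongr e)).arity none = S.arity none :=
    arity_relabel (Equiv.optionCongr e) S none
  simp only [blowUps, Set.mem_ofPred_eq, isContraction_relabel, IsSpecialEdge,
    (edge_relabel_option e S x).1, (edge_relabel_option e S x).2, h]

theorem sign_relabel (e : α ≃ β) (S : RTree (Option α)) (x : α) :
    sign (S.relabel (Equiv.optionCongr e), e x) = sign (S, x) := by
  unfold sign
  by_cases h : S.Edge (some x) none
  · rw [if_pos h, if_pos ((edge_relabel_option e S x).1.2 h)]
  · rw [if_neg h, if_neg (fun h' => h ((edge_relabel_option e S x).1.1 h'))]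

/-! ### Grafting -/

open Classical in
/-- The tree on the disjoint union of the vertices of `T` and `S` in which the root of `S` is
connected by a new edge with the vertex `a` of `T`; its root is the root of `T`. -/
@[simps]
def graft (T : RTree α) (a : α) (S : RTree β) : RTree (α ⊕ β) where
  root := Sum.inl T.root
  parent := Sum.elim (fun x => Sum.inl (T.parent x))
    (fun y => if y = S.root then Sum.inl a else Sum.inr (S.parent y))
  parent_root := by simp [T.parent_root]
  reaches_root := by
    set p : α ⊕ β → α ⊕ β := Sum.elim (fun x => Sum.inl (T.parent x))
      (fun y => if y = S.root then Sum.inl a else Sum.inr (S.parent y)) with hp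
    have hl : ∀ x : α, ∃ m : ℕ, p^[m] (Sum.inl x) = Sum.inl T.root := by
      intro x
      obtain ⟨m, hm⟩ := T.reaches_root x
      refine ⟨m, ?_⟩
      induction m generalizing x with
      | zero => exact congrArg Sum.inl hm
      | succ j ih =>
        rw [Function.iterate_succ_apply] at hm ⊢
        exact ih (T.parent x) hm
    have hr : ∀ (m : ℕ) (y : β), S.parent^[m] y = S.root →
        ∃ j : ℕ, p^[j] (Sum.inr y) = Sum.inl T.root := by
      intro m
      induction m with
      | zero =>
        intro y hy
        obtain ⟨j, hj⟩ := hl a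
        refine ⟨j + 1, ?_⟩
        rw [Function.iterate_succ_apply]
        have : p (Sum.inr y) = Sum.inl a := by
          simp only [hp, Sum.elim_inr]
          exact if_pos hy
        rw [this, hj]
      | succ m ih =>
        intro y hy
        by_cases h : y = S.root
        · obtain ⟨j, hj⟩ := hl a
          refine ⟨j + 1, ?_⟩
          rw [Function.iterate_succ_apply]
          have : p (Sum.inr y) = Sum.inl a := by
            simp only [hp, Sum.elim_inr]
            exact if_pos h
          rw [this, hj]
        · obtain ⟨j, hj⟩ := ih (S.parent y) hy
          refine ⟨j + 1, ?_⟩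
          rw [Function.iterate_succ_apply]
          have : p (Sum.inr y) = Sum.inr (S.parent y) := by
            simp only [hp, Sum.elim_inr]
            exact if_neg h
          rw [this, hj]
    rintro (x | y)
    · exact hl x
    · obtain ⟨m, hm⟩ := S.reaches_root y
      exact hr m y hm

theorem graft_relabel {α' β' : Type*} (e : α ≃ α') (f : β ≃ β') (T : RTree α) (a : α)
    (S : RTree β) :
    graft (T.relabel e) (e a) (S.relabel f) = (graft T a S).relabel (Equiv.sumCongr e f) := by
  ext z
  · simp
  · rcases z with x | y
    · simp
    · obtain ⟨y, rfl⟩ := f.surjective y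
      by_cases h : y = S.root <;> simp [h]

end RTree

/-! ### Decorated trees -/

section Decorated

variable (k : Type*) [CommRing k] (V W : Type*) [AddCommGroup V] [Module k V]
  [AddCommGroup W] [Module k W] (n : ℕ)
variable (X : Type*) [MulAction (Equiv.Perm (Fin n)) X]

/-- The action of the symmetric group on `V^{⊗ n}` by permutation of the factors. -/
def permTensor : Representation k (Equiv.Perm (Fin n)) (⨂[k] _ : Fin n, V) where
  toFun σ := (PiTensorProduct.reindex k (fun _ : Fin n => V) σ).toLinearMap
  map_one' := by
    ext x
    exact PiTensorProduct.reindex_tprod (R := k) (s := fun _ => V) (1 : Equiv.Perm (Fin n)) x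
  map_mul' σ τ := by
    ext x
    have h : ∀ (ρ : Equiv.Perm (Fin n)) (y : Fin n → V),
        PiTensorProduct.reindex k (fun _ : Fin n => V) ρ (PiTensorProduct.tprod k y) =
          PiTensorProduct.tprod k fun i => y (ρ.symm i) :=
      fun ρ y => PiTensorProduct.reindex_tprod ρ y
    change PiTensorProduct.reindex k (fun _ : Fin n => V) (σ * τ) (PiTensorProduct.tprod k x) =
      PiTensorProduct.reindex k (fun _ : Fin n => V) σ
        (PiTensorProduct.reindex k (fun _ : Fin n => V) τ (PiTensorProduct.tprod k x))
    rw [h, h, h]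
    rfl

/-- `Span(X) ⊗ W` for a set `X` and a space `W`, realized as the space of finitely supported
functions from `X` to `W`, with `Finsupp.single x w` in the role of `x ⊗ w` (see
`TensorProduct.finsuppScalarLeft`). Here `W = V^{⊗ n}`. -/
abbrev SpanTensor : Type _ := X →₀ (⨂[k] _ : Fin n, V)

/-- The diagonal action of the symmetric group on `Span(X) ⊗ V^{⊗ n}`. -/
def diag (σ : Equiv.Perm (Fin n)) : SpanTensor k V n X →ₗ[k] SpanTensor k V n X :=
  Finsupp.lsum k fun x => Finsupp.lsingle (σ • x) ∘ₗ permTensor k V n σ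

@[simp] theorem diag_single (σ : Equiv.Perm (Fin n)) (x : X) (t : ⨂[k] _ : Fin n, V) :
    diag k V n X σ (Finsupp.single x t) = Finsupp.single (σ • x) (permTensor k V n σ t) := by
  simp [diag]

@[simp] theorem diag_one : diag k V n X 1 = LinearMap.id := by
  refine Finsupp.lhom_ext fun x t => ?_
  simp

/-- The span of the elements `σ z - z` with `σ ∈ Σₙ` and `z ∈ Span(X) ⊗ V^{⊗ n}`. -/
def diagKer : Submodule k (SpanTensor k V n X) :=
  Submodule.span k {d | ∃ (σ : Equiv.Perm (Fin n)) (z : SpanTensor k V n X),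
    d = diag k V n X σ z - z}

/-- `Span(X) ⊗_{Σₙ} V^{⊗ n}`, as the space of coinvariants of the diagonal action of `Σₙ` on
`Span(X) ⊗ V^{⊗ n}`. -/
def Decorated : Type _ := SpanTensor k V n X ⧸ diagKer k V n X

instance : AddCommGroup (Decorated k V n X) :=
  inferInstanceAs (AddCommGroup (SpanTensor k V n X ⧸ diagKer k V n X))

instance : Module k (Decorated k V n X) :=
  inferInstanceAs (Module k (SpanTensor k V n X ⧸ diagKer k V n X))

namespace Decorated

/-- The projection `Span(X) ⊗ V^{⊗ n} → Span(X) ⊗_{Σₙ} V^{⊗ n}`. -/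
def mk : SpanTensor k V n X →ₗ[k] Decorated k V n X := (diagKer k V n X).mkQ

theorem mk_surjective : Function.Surjective (mk k V n X) := (diagKer k V n X).mkQ_surjective

theorem mk_diag (σ : Equiv.Perm (Fin n)) (z : SpanTensor k V n X) :
    mk k V n X (diag k V n X σ z) = mk k V n X z :=
  (Submodule.Quotient.eq (diagKer k V n X)).2 (Submodule.subset_span ⟨σ, z, rfl⟩)

variable {k V n X}

/-- The linear map on `Span(X) ⊗_{Σₙ} V^{⊗ n}` induced by an invariant linear map. -/
def lift {U : Type*} [AddCommGroup U] [Module k U] (f : SpanTensor k V n X →ₗ[k] U)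
    (hf : ∀ σ z, f (diag k V n X σ z) = f z) : Decorated k V n X →ₗ[k] U :=
  (diagKer k V n X).liftQ f (by
    refine Submodule.span_le.2 ?_
    rintro _ ⟨σ, z, rfl⟩
    simp only [SetLike.mem_coe, LinearMap.mem_ker, map_sub, hf, sub_self])

@[simp] theorem lift_mk {U : Type*} [AddCommGroup U] [Module k U]
    (f : SpanTensor k V n X →ₗ[k] U) (hf : ∀ σ z, f (diag k V n X σ z) = f z) (z) :
    lift f hf (mk k V n X z) = f z := rfl

variable (k)

/-- The class of `x ⊗ v₁ ⊗ ⋯ ⊗ vₙ`. -/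
def of (x : X) (w : Fin n → V) : Decorated k V n X :=
  mk k V n X (Finsupp.single x (PiTensorProduct.tprod k w))

variable {W} (X)

/-- The linear map `Span(X) ⊗_{Σₙ} V^{⊗ n} → Span(X) ⊗_{Σₙ} W^{⊗ n}` induced by a linear map
`V → W`. -/
def map (f : V →ₗ[k] W) : Decorated k V n X →ₗ[k] Decorated k W n X :=
  lift (mk k W n X ∘ₗ Finsupp.mapRange.linearMap (PiTensorProduct.map fun _ : Fin n => f)) (by
    intro σ z
    have key : Finsupp.mapRange.linearMap (PiTensorProduct.map fun _ : Fin n => f)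
          (diag k V n X σ z) =
        diag k W n X σ
          (Finsupp.mapRange.linearMap (PiTensorProduct.map fun _ : Fin n => f) z) := by
      induction z using Finsupp.induction_linear with
      | zero => simp
      | add a b ha hb => simp only [map_add, ha, hb]
      | single x t =>
        have h : PiTensorProduct.map (fun _ : Fin n => f) (permTensor k V n σ t) =
            permTensor k W n σ (PiTensorProduct.map (fun _ : Fin n => f) t) :=
          PiTensorProduct.map_reindex (fun _ : Fin n => f) σ t
        simp only [diag_single, Finsupp.mapRange.linearMap_apply, Finsupp.mapRange_single, h]
    simp only [LinearMap.comp_apply, key, mk_diag])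

end Decorated

end Decorated

/-! ### The spaces `Tr(V)`, `Tr¹(V)` and the map `δ` -/

section Trees

variable (k : Type*) [CommRing k] (V W : Type*) [AddCommGroup V] [Module k V]
  [AddCommGroup W] [Module k W]

/-- The space `Tr(V) = ⨁ₙ Span(Trₙ) ⊗_{Σₙ} V^{⊗ n}` of rooted trees with vertices decorated by
elements of `V`. (There are no trees with `n = 0` vertices, so that the summand `n = 0`
vanishes.) -/
abbrev Tr : Type _ := ⨁ n : ℕ, Decorated k V n (RTree (Fin n))

/-- The space `Tr¹(V) = ⨁ₙ Span(Tr¹ₙ) ⊗_{Σₙ} V^{⊗ n}` of rooted trees with one special vertex, all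
other vertices being decorated by elements of `V`. -/
abbrev Tr1 : Type _ := ⨁ n : ℕ, Decorated k V n (RTree (Option (Fin n)))

variable {V} in
/-- The rooted tree `T` with vertices decorated by `w`. -/
def Tr.of {n : ℕ} (T : RTree (Fin n)) (w : Fin n → V) : Tr k V :=
  DirectSum.lof k ℕ (fun n => Decorated k V n (RTree (Fin n))) n (Decorated.of k T w)

variable {V} in
/-- The one-vertex tree decorated by `x`. -/
def Tr.vertex (x : V) : Tr k V := Tr.of k (RTree.single (Fin 1)) (fun _ => x)

variable {V W} in
/-- The functoriality of `Tr(V)` in `V`. -/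
def Tr.map (f : V →ₗ[k] W) : Tr k V →ₗ[k] Tr k W :=
  DirectSum.lmap fun n => Decorated.map k (RTree (Fin n)) f

open Classical in
/-- The map `T ⊗ t ↦ ∑ ε_{(S,e)} S ⊗ t`, the sum being over all blow-ups `(S, e)` of `T`. -/
def deltaTensor (n : ℕ) :
    SpanTensor k V n (RTree (Fin n)) →ₗ[k] SpanTensor k V n (RTree (Option (Fin n))) :=
  Finsupp.lsum k fun T => ∑ p : RTree (Option (Fin n)) × Fin n with p ∈ T.blowUps,
    RTree.sign p • Finsupp.lsingle p.1

open Classical in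
theorem deltaTensor_single {n : ℕ} (T : RTree (Fin n)) (t) :
    deltaTensor k V n (Finsupp.single T t) =
      ∑ p : RTree (Option (Fin n)) × Fin n with p ∈ T.blowUps,
        RTree.sign p • Finsupp.single p.1 t := by
  rw [deltaTensor, Finsupp.lsum_single, LinearMap.sum_apply]
  rfl

theorem deltaTensor_diag {n : ℕ} (σ : Equiv.Perm (Fin n)) (z) :
    deltaTensor k V n (diag k V n _ σ z) = diag k V n _ σ (deltaTensor k V n z) := by
  classical
  induction z using Finsupp.induction_linear with
  | zero => rw [map_zero, map_zero, map_zero]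
  | add a b ha hb => rw [map_add, map_add, map_add, map_add, ha, hb]
  | single T t =>
    rw [diag_single, deltaTensor_single, deltaTensor_single, map_sum]
    symm
    refine Finset.sum_equiv
      ((RTree.relabelEquiv (Equiv.optionCongr σ)).prodCongr σ) ?_ ?_
    · rintro ⟨S, x⟩
      rw [Finset.mem_filter_univ, Finset.mem_filter_univ]
      exact (RTree.mem_blowUps_relabel σ S x T).symm
    · rintro ⟨S, x⟩ -
      rw [map_zsmul, diag_single]
      exact congrArg (fun z : ℤ => z • Finsupp.single (σ • S) (permTensor k V n σ t))
        (RTree.sign_relabel σ S x).symm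

/-- The map `δ : Tr(V) → Tr¹(V)`, which sends a decorated tree to the signed sum of its
blow-ups. -/
def delta : Tr k V →ₗ[k] Tr1 k V :=
  DirectSum.lmap fun n =>
    Decorated.lift (Decorated.mk k V n (RTree (Option (Fin n))) ∘ₗ deltaTensor k V n) (by
      intro σ z
      simp only [LinearMap.comp_apply, deltaTensor_diag, Decorated.mk_diag])

/-! ### The pre-Lie product of decorated trees -/

/-- Juxtaposition of permutations. -/
def juxt {m n : ℕ} (σ : Equiv.Perm (Fin m)) (τ : Equiv.Perm (Fin n)) : Equiv.Perm (Fin (m + n)) :=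
  (finSumFinEquiv.symm.trans (Equiv.sumCongr σ τ)).trans finSumFinEquiv

/-- The concatenation of tensors `V^{⊗ m} × V^{⊗ n} → V^{⊗ (m + n)}`. -/
def concat (m n : ℕ) :
    (⨂[k] _ : Fin m, V) →ₗ[k] (⨂[k] _ : Fin n, V) →ₗ[k] ⨂[k] _ : Fin (m + n), V :=
  TensorProduct.curry
    ((PiTensorProduct.reindex k (fun _ : Fin m ⊕ Fin n => V) finSumFinEquiv).toLinearMap ∘ₗ
      (PiTensorProduct.tmulEquiv k V).toLinearMap)

theorem concat_tprod {m n : ℕ} (x : Fin m → V) (y : Fin n → V) :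
    concat k V m n (PiTensorProduct.tprod k x) (PiTensorProduct.tprod k y) =
      PiTensorProduct.tprod k fun i => Sum.elim x y (finSumFinEquiv.symm i) := by
  simp only [concat, TensorProduct.curry_apply, LinearMap.comp_apply, LinearEquiv.coe_coe,
    PiTensorProduct.tmulEquiv_apply]
  exact PiTensorProduct.reindex_tprod (s := fun _ : Fin m ⊕ Fin n => V) finSumFinEquiv (Sum.elim x y)

theorem permTensor_tprod {n : ℕ} (σ : Equiv.Perm (Fin n)) (x : Fin n → V) :
    permTensor k V n σ (PiTensorProduct.tprod k x) =
      PiTensorProduct.tprod k fun i => x (σ.symm i) :=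
  PiTensorProduct.reindex_tprod (s := fun _ : Fin n => V) σ x

theorem concat_perm {m n : ℕ} (σ : Equiv.Perm (Fin m)) (τ : Equiv.Perm (Fin n)) (s t) :
    concat k V m n (permTensor k V m σ s) (permTensor k V n τ t) =
      permTensor k V (m + n) (juxt σ τ) (concat k V m n s t) := by
  induction s using PiTensorProduct.induction_on with
  | add a b ha hb => simp only [map_add, LinearMap.add_apply, ha, hb]
  | smul_tprod r x =>
  induction t using PiTensorProduct.induction_on with
  | add a b ha hb => simp only [map_add, ha, hb]
  | smul_tprod c y =>
    simp only [map_smul, LinearMap.smul_apply, permTensor_tprod, concat_tprod]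
    congr 3
    funext i
    obtain ⟨z, rfl⟩ := finSumFinEquiv.surjective i
    rcases z with z | z <;> simp [juxt]

/-- The bilinear map `(T ⊗ s, S ⊗ t) ↦ ∑ R ⊗ st`, where `R` runs over the trees obtained by grafting
`S` onto the vertices `a` of `T`. -/
def starTensor (m n : ℕ) :
    SpanTensor k V m (RTree (Fin m)) →ₗ[k] SpanTensor k V n (RTree (Fin n)) →ₗ[k]
      SpanTensor k V (m + n) (RTree (Fin (m + n))) :=
  Finsupp.lsum k fun T => LinearMap.flip <| Finsupp.lsum k fun S => LinearMap.flip <|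
    ∑ a : Fin m, (concat k V m n).compr₂ (Finsupp.lsingle ((T.graft a S).relabel finSumFinEquiv))

theorem starTensor_single {m n : ℕ} (T : RTree (Fin m)) (S : RTree (Fin n)) (s t) :
    starTensor k V m n (Finsupp.single T s) (Finsupp.single S t) =
      ∑ a : Fin m, Finsupp.single ((T.graft a S).relabel finSumFinEquiv) (concat k V m n s t) := by
  simp [starTensor, LinearMap.sum_apply]

theorem starTensor_diag {m n : ℕ} (σ : Equiv.Perm (Fin m)) (τ : Equiv.Perm (Fin n)) (a b) :
    starTensor k V m n (diag k V m _ σ a) (diag k V n _ τ b) =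
      diag k V (m + n) _ (juxt σ τ) (starTensor k V m n a b) := by
  induction a using Finsupp.induction_linear with
  | zero => simp
  | add a a' h h' => simp only [map_add, LinearMap.add_apply, h, h']
  | single T s =>
  induction b using Finsupp.induction_linear with
  | zero => simp
  | add b b' h h' => simp only [map_add, h, h']
  | single S t =>
    simp only [diag_single, starTensor_single, map_sum, concat_perm]
    symm
    refine Fintype.sum_equiv σ _ _ fun a => ?_
    congr 1
    simp only [RTree.smul_def, RTree.graft_relabel, RTree.relabel_relabel]
    congr 1
    ext z
    simp [juxt]

/-- The grafting product on decorated trees with `m` and `n` vertices. -/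
def starHom (m n : ℕ) :
    Decorated k V m (RTree (Fin m)) →ₗ[k] Decorated k V n (RTree (Fin n)) →ₗ[k]
      Decorated k V (m + n) (RTree (Fin (m + n))) :=
  Decorated.lift
    (LinearMap.flip (Decorated.lift
      (LinearMap.flip ((starTensor k V m n).compr₂
        (Decorated.mk k V (m + n) (RTree (Fin (m + n)))))) (by
        intro τ b
        refine LinearMap.ext fun a => ?_
        have h := starTensor_diag k V (1 : Equiv.Perm (Fin m)) τ a b
        rw [diag_one, LinearMap.id_apply] at h
        simp only [LinearMap.flip_apply, LinearMap.compr₂_apply]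
        rw [h, Decorated.mk_diag]))) (by
    intro σ a
    refine LinearMap.ext fun z => ?_
    obtain ⟨b, rfl⟩ := Decorated.mk_surjective k V n (RTree (Fin n)) z
    have h := starTensor_diag k V σ (1 : Equiv.Perm (Fin n)) a b
    rw [diag_one, LinearMap.id_apply] at h
    simp only [LinearMap.flip_apply, Decorated.lift_mk, LinearMap.compr₂_apply]
    rw [h, Decorated.mk_diag])

/-- The pre-Lie product `T ⋆ S` of decorated trees: the sum over the vertices of `T` of the
decorated trees obtained by connecting the root of `S` by a new edge with this vertex. -/
def star : Tr k V →ₗ[k] Tr k V →ₗ[k] Tr k V :=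
  DirectSum.toModule k ℕ _ fun m => LinearMap.flip (DirectSum.toModule k ℕ _ fun n =>
    LinearMap.flip ((starHom k V m n).compr₂
      (DirectSum.lof k ℕ (fun n => Decorated k V n (RTree (Fin n))) (m + n))))

end Trees

/-! ### The free Lie algebra on a vector space -/

section FreeLie

variable (k : Type*) [CommRing k] (V W : Type*) [AddCommGroup V] [Module k V]
  [AddCommGroup W] [Module k W]

/-- The relations, in the free Lie algebra on the underlying set of `V`, which express that the
canonical map from `V` is linear. -/
def linearityRelations : Set (FreeLieAlgebra k V) :=
  {z | (∃ x y : V, z = FreeLieAlgebra.of k (x + y) - FreeLieAlgebra.of k x - FreeLieAlgebra.of k y) ∨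
    ∃ (c : k) (x : V), z = FreeLieAlgebra.of k (c • x) - c • FreeLieAlgebra.of k x}

/-- The Lie ideal generated by the linearity relations. -/
def linearityIdeal : LieIdeal k (FreeLieAlgebra k V) :=
  LieSubmodule.lieSpan k (FreeLieAlgebra k V) (linearityRelations k V)

/-- The free Lie algebra `L(V)` on the vector space `V`: it has the universal property that every
linear map from `V` to a Lie algebra extends uniquely to a homomorphism of Lie algebras. -/
abbrev FreeLie : Type _ := FreeLieAlgebra k V ⧸ linearityIdeal k V

variable {V W}

namespace FreeLie

/-- The canonical linear map from `V` to the free Lie algebra on `V`. -/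
def of : V →ₗ[k] FreeLie k V where
  toFun x := LieSubmodule.Quotient.mk (FreeLieAlgebra.of k x)
  map_add' x y := by
    rw [← Submodule.Quotient.mk_add, Submodule.Quotient.eq]
    refine LieSubmodule.subset_lieSpan (Or.inl ⟨x, y, ?_⟩)
    abel
  map_smul' c x := by
    rw [RingHom.id_apply, ← Submodule.Quotient.mk_smul, Submodule.Quotient.eq]
    exact LieSubmodule.subset_lieSpan (Or.inr ⟨c, x, rfl⟩)

variable {L : Type*} [LieRing L] [LieAlgebra k L]

/-- The homomorphism from the free Lie algebra which extends a given linear map. -/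
def lift (f : V →ₗ[k] L) : FreeLie k V →ₗ⁅k⁆ L where
  toLinearMap := Submodule.liftQ _ (FreeLieAlgebra.lift k f : FreeLieAlgebra k V →ₗ[k] L) (by
    have h : linearityIdeal k V ≤ (FreeLieAlgebra.lift k (f : V → L)).ker := by
      refine LieSubmodule.lieSpan_le.2 ?_
      rintro z (⟨x, y, rfl⟩ | ⟨c, x, rfl⟩) <;> simp [LieHom.mem_ker]
    intro z hz
    exact LieHom.mem_ker.1 (h hz))
  map_lie' {x y} := by
    induction x using Submodule.Quotient.induction_on
    induction y using Submodule.Quotient.induction_on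
    exact LieHom.map_lie (FreeLieAlgebra.lift k (f : V → L)) _ _

@[simp] theorem lift_of (f : V →ₗ[k] L) (x : V) : lift k f (of k x) = f x :=
  FreeLieAlgebra.lift_of_apply (f : V → L) x

theorem hom_ext {F G : FreeLie k V →ₗ⁅k⁆ L} (h : ∀ x, F (of k x) = G (of k x)) : F = G := by
  let π : FreeLieAlgebra k V →ₗ⁅k⁆ FreeLie k V :=
    { (linearityIdeal k V).toSubmodule.mkQ with map_lie' := fun {_ _} => rfl }
  have key : F.comp π = G.comp π := FreeLieAlgebra.hom_ext h
  ext z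
  induction z using Submodule.Quotient.induction_on with
  | _ z => exact LieHom.congr_fun key z

/-- The functoriality of `L(V)` in `V`. -/
def map (f : V →ₗ[k] W) : FreeLie k V →ₗ⁅k⁆ FreeLie k W := lift k (of k ∘ₗ f)

end FreeLie

end FreeLie

end LieTrees

end

/-!
Functions on trees which are annihilated by `δ` change sign when the root moves to one of its
children, and inserting the special vertex above a vertex of arity at least two expresses their
value on a tree through the values on taller trees with the same root. They are thus determined by
their values on the ladders with any given root `z`.

The left-normed bracket of `v₀, …, vₙ` has the coefficient `(-1) ^ d` in the trees in which every
`vᵢ` with `i > 0` has exactly one neighbour `vⱼ` with `j < i`, where `d` is the depth of `v₀`, and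
the coefficient `0` in all other trees. These coefficients are annihilated by `δ`, and those of the
orderings which start with `z` form the dual basis to the ladders with root `z`. So the functions
annihilated by `δ` are spanned by brackets. Since `δ` acts on coinvariants, while this argument
concerns functions, one has to symmetrize, which requires dividing by `n!`.

For injectivity, reading off the coefficients of the ladders defines a linear map `Tr(V) → L(V)`.
As `⋆` is right-symmetric, its composition with `L(V) → Tr(V)` is a derivation, which is the
identity on `V`. So it multiplies left-normed brackets of length `n` by `n`, as in the theorem of
Dynkin, Specht and Wever, and dividing by `n` yields a left inverse.
-/

noncomputable section

namespace LieTrees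

namespace RTree

variable {α β : Type*}

/-! ### Depth and adjacency -/

open Classical in
/-- The depth of a vertex: its distance from the root. -/
def depth (T : RTree α) (a : α) : ℕ := Nat.find (T.reaches_root a)

theorem parent_iterate_depth (T : RTree α) (a : α) : T.parent^[T.depth a] a = T.root := by
  classical exact Nat.find_spec (T.reaches_root a)

theorem depth_le_of_parent_iterate (T : RTree α) {a : α} {m : ℕ} (h : T.parent^[m] a = T.root) :
    T.depth a ≤ m := by
  classical exact Nat.find_min' (T.reaches_root a) h

@[simp] theorem depth_root (T : RTree α) : T.depth T.root = 0 :=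
  Nat.le_zero.1 (T.depth_le_of_parent_iterate (m := 0) rfl)

theorem depth_eq_zero_iff (T : RTree α) {a : α} : T.depth a = 0 ↔ a = T.root := by
  refine ⟨fun h => ?_, fun h => h ▸ T.depth_root⟩
  simpa only [h, Function.iterate_zero, id_eq] using T.parent_iterate_depth a

theorem depth_eq_depth_parent_add_one (T : RTree α) {a : α} (ha : a ≠ T.root) :
    T.depth a = T.depth (T.parent a) + 1 := by
  apply le_antisymm
  · exact T.depth_le_of_parent_iterate (T.parent_iterate_depth (T.parent a))
  · obtain ⟨d, hd⟩ := Nat.exists_eq_succ_of_ne_zero (mt T.depth_eq_zero_iff.1 ha)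
    have h := T.parent_iterate_depth a
    rw [hd, Function.iterate_succ_apply] at h
    rw [hd]
    exact Nat.succ_le_succ (T.depth_le_of_parent_iterate h)

theorem parent_induction (T : RTree α) {p : α → Prop} (root : p T.root)
    (parent : ∀ a, a ≠ T.root → p (T.parent a) → p a) (a : α) : p a := by
  induction hd : T.depth a generalizing a with
  | zero => exact T.depth_eq_zero_iff.1 hd ▸ root
  | succ d ih =>
    have ha : a ≠ T.root := fun h => by simp [h] at hd
    have := T.depth_eq_depth_parent_add_one ha
    exact parent a ha (ih _ (by omega))

theorem parent_ne_self (T : RTree α) {a : α} (ha : a ≠ T.root) : T.parent a ≠ a := fun h => by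
  have := T.depth_eq_depth_parent_add_one ha
  rw [h] at this
  omega

theorem parent_eq_self_iff (T : RTree α) {a : α} : T.parent a = a ↔ a = T.root :=
  ⟨fun h => by_contra fun ha => T.parent_ne_self ha h, fun h => h ▸ T.parent_root⟩

theorem edge_parent (T : RTree α) {a : α} (ha : a ≠ T.root) : T.Edge a (T.parent a) :=
  ⟨(T.parent_ne_self ha).symm, rfl⟩

theorem Edge.ne_root {T : RTree α} {a b : α} (h : T.Edge a b) : a ≠ T.root := by
  rintro rfl
  exact h.1 (T.parent_root.symm.trans h.2)

theorem Edge.depth {T : RTree α} {a b : α} (h : T.Edge a b) : T.depth a = T.depth b + 1 :=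
  h.2 ▸ T.depth_eq_depth_parent_add_one h.ne_root

theorem Edge.not_edge {T : RTree α} {a b : α} (h : T.Edge a b) : ¬T.Edge b a := fun h' => by
  have := h.depth
  have := h'.depth
  omega

theorem le_depth (T : RTree α) {r : α → ℕ} (root : r T.root = 0)
    (parent : ∀ a, a ≠ T.root → r a ≤ r (T.parent a) + 1) (a : α) : r a ≤ T.depth a := by
  refine T.parent_induction (p := fun a => r a ≤ T.depth a) (by omega) (fun a ha ih => ?_) a
  have := T.depth_eq_depth_parent_add_one ha
  have := parent a ha
  omega

theorem exists_depth_eq (T : RTree α) (a : α) {j : ℕ} (hj : j ≤ T.depth a) :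
    ∃ b, T.depth b = j := by
  refine T.parent_induction (p := fun a => j ≤ T.depth a → ∃ b, T.depth b = j)
    (fun h => ⟨T.root, by simp_all⟩) (fun a ha ih h => ?_) a hj
  have := T.depth_eq_depth_parent_add_one ha
  obtain h | h := h.eq_or_lt
  · exact ⟨a, h.symm⟩
  · exact ih (by omega)

theorem ext_of_parent {S T : RTree α} (h : S.parent = T.parent) : S = T :=
  RTree.ext (T.parent_eq_self_iff.1 (h ▸ S.parent_root)) h

theorem ext_of_edge {S T : RTree α} (h : ∀ a b, S.Edge a b ↔ T.Edge a b) : S = T := by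
  refine ext_of_parent (funext fun a => ?_)
  by_cases ha : a = T.root
  · have hS : a = S.root := by_contra fun h' => ((h _ _).1 (S.edge_parent h')).ne_root ha
    rw [S.parent_eq_self_iff.2 hS, T.parent_eq_self_iff.2 ha]
  · exact ((h _ _).2 (T.edge_parent ha)).2

/-- The tree with a given root and a given parent function, whose being a tree is witnessed by a
rank which decreases along the edges. -/
def ofRank (root : α) (parent : α → α) (parent_root : parent root = root) (rank : α → ℕ)
    (rank_parent : ∀ a, a ≠ root → rank (parent a) < rank a) : RTree α where
  root := root
  parent := parent
  parent_root := parent_root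
  reaches_root a := by
    induction hn : rank a using Nat.strong_induction_on generalizing a with
    | _ n ih =>
      by_cases ha : a = root
      · exact ⟨0, ha⟩
      · obtain ⟨m, hm⟩ := ih _ (hn ▸ rank_parent a ha) (parent a) rfl
        exact ⟨m + 1, hm⟩

/-- Two vertices are adjacent if there is an edge between them, in either direction. -/
def Adj (T : RTree α) (a b : α) : Prop := T.Edge a b ∨ T.Edge b a

theorem Adj.symm {T : RTree α} {a b : α} (h : T.Adj a b) : T.Adj b a := Or.symm h

theorem Adj.ne {T : RTree α} {a b : α} (h : T.Adj a b) : a ≠ b :=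
  h.elim (fun h => h.1) (fun h => h.1.symm)

theorem Adj.not_adj {T : RTree α} {a b c : α} (hb : T.Adj a b) (hc : T.Adj a c) :
    ¬T.Adj b c := fun h => by
  have depth_sub : ∀ {a b}, T.Adj a b → T.depth a = T.depth b + 1 ∨ T.depth b = T.depth a + 1 :=
    fun h => h.imp Edge.depth Edge.depth
  have := depth_sub hb
  have := depth_sub hc
  have := depth_sub h
  omega

theorem adj_relabel (e : α ≃ β) (T : RTree α) (a b : α) :
    (T.relabel e).Adj (e a) (e b) ↔ T.Adj a b := by
  simp only [Adj, edge_relabel]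

theorem two_le_arity [Finite α] {T : RTree α} {a b c : α} (hab : a ≠ b) (ha : T.Edge a c)
    (hb : T.Edge b c) : 2 ≤ T.arity c :=
  (Set.one_lt_ncard_iff (Set.toFinite _)).2 ⟨a, b, ha, hb, hab⟩

theorem exists_edge_of_two_le_arity {T : RTree α} {c : α} (h : 2 ≤ T.arity c) :
    ∃ a b, a ≠ b ∧ T.Edge a c ∧ T.Edge b c := by
  obtain ⟨a, ha, b, hb, hab⟩ := (Set.one_lt_ncard (Set.finite_of_ncard_pos (by
    unfold arity at h; omega))).1 h
  exact ⟨a, b, hab, ha, hb⟩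

/-! ### Contraction of special edges -/

@[simp] theorem collapse_none (x : α) : collapse x none = x := rfl

@[simp] theorem collapse_some (x a : α) : collapse x (some a) = a := rfl

theorem isSpecialEdge_iff {S : RTree (Option α)} {x : α} :
    IsSpecialEdge S x ↔ S.parent (some x) = none ∨ S.parent none = some x := by
  simp [IsSpecialEdge, Edge]

theorem IsSpecialEdge.adj {S : RTree (Option α)} {x : α} (hx : IsSpecialEdge S x) :
    S.Adj none (some x) := Or.symm hx

theorem parent_some_ne_none {S : RTree (Option α)} {x : α} (hx : S.parent none = some x) :
    S.parent (some x) ≠ none := fun h =>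
  Edge.not_edge (T := S) ⟨by simp, hx⟩ ⟨by simp, h⟩

theorem sign_of_parent_some {S : RTree (Option α)} {x : α} (h : S.parent (some x) = none) :
    sign (S, x) = 1 := by
  simp [sign, Edge, h]

theorem sign_of_parent_none {S : RTree (Option α)} {x : α} (h : S.parent none = some x) :
    sign (S, x) = -1 :=
  if_neg fun h' => parent_some_ne_none h h'.2

open Classical in
/-- The vertex of `S` at which the outgoing edge of the vertex `a` of `S/e` starts: the contracted
vertex `x` stands for two vertices of `S`, and its outgoing edge comes from the one which is closer
to the root. -/
def contractRep (S : RTree (Option α)) (x a : α) : Option α :=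
  if a = x ∧ S.parent (some x) = none then none else some a

theorem contractRep_of_ne (S : RTree (Option α)) {x a : α} (h : a ≠ x) :
    contractRep S x a = some a := if_neg fun h' => h h'.1

theorem contractRep_of_parent_some {S : RTree (Option α)} {x : α}
    (h : S.parent (some x) = none) : contractRep S x x = none := if_pos ⟨rfl, h⟩

theorem contractRep_of_parent_none {S : RTree (Option α)} {x : α}
    (h : S.parent none = some x) (a : α) : contractRep S x a = some a :=
  if_neg fun h' => parent_some_ne_none h h'.2

theorem collapse_contractRep (S : RTree (Option α)) (x a : α) :
    collapse x (contractRep S x a) = a := by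
  unfold contractRep
  split_ifs with h
  exacts [h.1.symm, rfl]

theorem IsSpecialEdge.contractRep_collapse {S : RTree (Option α)} {x : α}
    (hx : IsSpecialEdge S x) (o : Option α) :
    contractRep S x (collapse x o) = o ∨
      S.Edge o (contractRep S x (collapse x o)) ∧ collapse x (S.parent o) = collapse x o := by
  rcases isSpecialEdge_iff.1 hx with h | h <;> rcases o with _ | a
  · exact Or.inl (contractRep_of_parent_some h)
  · by_cases ha : a = x
    · subst ha
      rw [collapse_some, contractRep_of_parent_some h, h]
      exact Or.inr ⟨⟨by simp, h⟩, rfl⟩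
    · exact Or.inl (contractRep_of_ne S ha)
  · rw [contractRep_of_parent_none h, h]
    exact Or.inr ⟨⟨by simp, h⟩, rfl⟩
  · exact Or.inl (contractRep_of_parent_none h a)

/-- The tree `S/e` obtained by contracting the special edge `e` with nonspecial endpoint `x`. -/
@[simps! root parent]
def contract (S : RTree (Option α)) {x : α} (hx : IsSpecialEdge S x) : RTree α :=
  ofRank (collapse x S.root) (fun a => collapse x (S.parent (contractRep S x a)))
    (by
      rcases hx.contractRep_collapse S.root with h | ⟨h, -⟩
      · rw [h, S.parent_root]
      · exact absurd rfl h.ne_root)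
    (fun a => S.depth (contractRep S x a))
    (by
      intro a ha
      have hroot : contractRep S x a ≠ S.root := fun h => ha (by rw [← h, collapse_contractRep])
      have hlt := S.depth_eq_depth_parent_add_one hroot
      rcases hx.contractRep_collapse (S.parent (contractRep S x a)) with h | ⟨h, -⟩
      · rw [h]
        omega
      · have := h.depth
        omega)

theorem edge_contract {S : RTree (Option α)} {x : α} (hx : IsSpecialEdge S x) (a b : α) :
    (S.contract hx).Edge a b ↔
      a ≠ b ∧ ∃ a' b', S.Edge a' b' ∧ collapse x a' = a ∧ collapse x b' = b := by
  refine and_congr_right fun hab => ⟨fun h => ?_, ?_⟩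
  · refine ⟨contractRep S x a, _, ⟨fun h' => hab ?_, rfl⟩, collapse_contractRep S x a, h⟩
    rw [← h, contract_parent, ← h', collapse_contractRep]
  · rintro ⟨a', b', ⟨-, rfl⟩, rfl, rfl⟩
    rcases hx.contractRep_collapse a' with h | ⟨-, h⟩
    · rw [contract_parent, h]
    · exact absurd h.symm hab

theorem isContraction_iff {S : RTree (Option α)} {x : α} (hx : IsSpecialEdge S x) (T : RTree α) :
    IsContraction S x T ↔ T = S.contract hx := by
  constructor
  · rintro ⟨-, h⟩
    exact ext_of_edge fun a b => (h a b).trans (edge_contract hx a b).symm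
  · rintro rfl
    exact ⟨rfl, edge_contract hx⟩

theorem adj_contract {S : RTree (Option α)} {x : α} (hx : IsSpecialEdge S x) (a b : α) :
    (S.contract hx).Adj a b ↔ a ≠ b ∧ (S.Adj (some a) (some b) ∨ (a = x ∧ IsSpecialEdge S b) ∨
      (b = x ∧ IsSpecialEdge S a)) := by
  have exists_edge_iff : ∀ a b : α,
      (∃ a' b', S.Edge a' b' ∧ collapse x a' = a ∧ collapse x b' = b) ↔
        S.Edge (some a) (some b) ∨ (a = x ∧ S.Edge none (some b)) ∨
          (b = x ∧ S.Edge (some a) none) := by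
    intro a b
    constructor
    · rintro ⟨_ | a', _ | b', h, rfl, rfl⟩
      · exact absurd rfl h.1
      · exact Or.inr (Or.inl ⟨rfl, h⟩)
      · exact Or.inr (Or.inr ⟨rfl, h⟩)
      · exact Or.inl h
    · rintro (h | ⟨rfl, h⟩ | ⟨rfl, h⟩) <;> exact ⟨_, _, h, rfl, rfl⟩
  have hab := edge_contract hx a b
  have hba := edge_contract hx b a
  rw [exists_edge_iff] at hab hba
  have : a ≠ b ↔ b ≠ a := ne_comm
  simp only [Adj, IsSpecialEdge]
  tauto

theorem contract_parent_of_ne {S : RTree (Option α)} {x a : α} (hx : IsSpecialEdge S x)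
    (ha : a ≠ x) : (S.contract hx).parent a = collapse x (S.parent (some a)) := by
  rw [contract_parent, contractRep_of_ne S ha]

theorem contract_parent_of_parent_some {S : RTree (Option α)} {x : α}
    (h : S.parent (some x) = none) (hx : IsSpecialEdge S x) :
    (S.contract hx).parent x = collapse x (S.parent none) := by
  rw [contract_parent, contractRep_of_parent_some h]

theorem contract_parent_of_parent_none {S : RTree (Option α)} {x : α}
    (h : S.parent none = some x) (hx : IsSpecialEdge S x) (a : α) :
    (S.contract hx).parent a = collapse x (S.parent (some a)) := by
  rw [contract_parent, contractRep_of_parent_none h]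

/-! ### Balanced functions -/

open Classical in
/-- A function on trees with values in an abelian group is balanced if it is annihilated by `δ`: for
every tree with a special vertex of arity at least two, the signed sum of its values over the
contractions of the special edges vanishes. -/
def IsBalanced [Fintype α] {M : Type*} [AddCommGroup M] (f : RTree α → M) : Prop :=
  ∀ S : RTree (Option α), 2 ≤ S.arity none →
    ∑ x : {x // IsSpecialEdge S x}, sign (S, x.1) • f (S.contract x.2) = 0

/-- A ladder is a tree in which every vertex has arity at most one. -/
def IsLadder (T : RTree α) : Prop :=
  ∀ a b, a ≠ T.root → b ≠ T.root → T.parent a = T.parent b → a = b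

open Classical in
/-- The tree with a special vertex obtained from `T` by inserting the special vertex between `p` and
all the children of `p`. -/
def insertAbove (T : RTree α) (p : α) : RTree (Option α) :=
  ofRank (some T.root)
    (fun o => o.elim (some p)
      fun a => if T.parent a = p ∧ a ≠ T.root then none else some (T.parent a))
    (by simp [T.parent_root])
    (fun o => o.elim (2 * T.depth p + 1) fun a => 2 * T.depth a)
    (by
      rintro (_ | a) ha
      · simp
      · have ha : a ≠ T.root := fun h => ha (congrArg some h)
        have hd := T.depth_eq_depth_parent_add_one ha
        by_cases h : T.parent a = p
        · rw [h] at hd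
          simp only [Option.elim_some, Option.elim_none, if_pos (And.intro h ha)]
          omega
        · simp [h, hd])

@[simp] theorem insertAbove_parent_none (T : RTree α) (p : α) :
    (T.insertAbove p).parent none = some p := rfl

theorem insertAbove_parent_some (T : RTree α) {p a : α} (h : T.parent a = p) (ha : a ≠ T.root) :
    (T.insertAbove p).parent (some a) = none := if_pos ⟨h, ha⟩

theorem insertAbove_parent_some_of_not (T : RTree α) {p a : α}
    (h : ¬(T.parent a = p ∧ a ≠ T.root)) :
    (T.insertAbove p).parent (some a) = some (T.parent a) := if_neg h

theorem isSpecialEdge_insertAbove_iff {T : RTree α} {p x : α} :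
    IsSpecialEdge (T.insertAbove p) x ↔ (T.parent x = p ∧ x ≠ T.root) ∨ x = p := by
  rw [isSpecialEdge_iff, insertAbove_parent_none, Option.some_inj, eq_comm (a := p)]
  refine or_congr_left ⟨fun h => ?_, fun h => insertAbove_parent_some T h.1 h.2⟩
  by_contra h'
  simp [insertAbove_parent_some_of_not T h'] at h

theorem contract_insertAbove (T : RTree α) {p : α} (h : IsSpecialEdge (T.insertAbove p) p) :
    (T.insertAbove p).contract h = T := by
  refine ext_of_parent (funext fun a => ?_)
  rw [contract_parent_of_parent_none rfl]
  by_cases ha : T.parent a = p ∧ a ≠ T.root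
  · rw [insertAbove_parent_some T ha.1 ha.2, collapse_none, ha.1]
  · rw [insertAbove_parent_some_of_not T ha, collapse_some]

section ContractInsertAbove

variable {T : RTree α} {x : α} (hx : IsSpecialEdge (T.insertAbove (T.parent x)) x)

theorem contract_insertAbove_parent_self (hr : x ≠ T.root) :
    ((T.insertAbove (T.parent x)).contract hx).parent x = T.parent x := by
  rw [contract_parent_of_parent_some (insertAbove_parent_some T rfl hr), insertAbove_parent_none,
    collapse_some]

theorem contract_insertAbove_parent_sibling {a : α} (ha : a ≠ T.root) (hax : a ≠ x)
    (h : T.parent a = T.parent x) : ((T.insertAbove (T.parent x)).contract hx).parent a = x := by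
  rw [contract_parent_of_ne hx hax, insertAbove_parent_some T h ha, collapse_none]

theorem contract_insertAbove_parent_of_ne {a : α} (hax : a ≠ x) (h : T.parent a ≠ T.parent x) :
    ((T.insertAbove (T.parent x)).contract hx).parent a = T.parent a := by
  rw [contract_parent_of_ne hx hax, insertAbove_parent_some_of_not T fun h' => h h'.1,
    collapse_some]

theorem depth_le_depth_contract_insertAbove (hr : x ≠ T.root) (a : α) :
    T.depth a ≤ ((T.insertAbove (T.parent x)).contract hx).depth a := by
  refine le_depth ((T.insertAbove (T.parent x)).contract hx) (r := T.depth) T.depth_root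
    (fun a (ha : a ≠ T.root) => ?_) a
  have hdx := T.depth_eq_depth_parent_add_one hr
  have hda := T.depth_eq_depth_parent_add_one (a := a) ha
  by_cases hax : a = x
  · rw [hax, contract_insertAbove_parent_self hx hr, hdx]
  by_cases h : T.parent a = T.parent x
  · rw [contract_insertAbove_parent_sibling hx ha hax h, hda, h, hdx]
    omega
  · rw [contract_insertAbove_parent_of_ne hx hax h, hda]

theorem depth_lt_depth_contract_insertAbove (hr : x ≠ T.root) {a : α} (ha : a ≠ T.root)
    (hax : a ≠ x) (h : T.parent a = T.parent x) :
    T.depth a < ((T.insertAbove (T.parent x)).contract hx).depth a := by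
  have hx_le := depth_le_depth_contract_insertAbove hx hr x
  have hda' := depth_eq_depth_parent_add_one ((T.insertAbove (T.parent x)).contract hx) (a := a) ha
  rw [contract_insertAbove_parent_sibling hx ha hax h] at hda'
  have hda := T.depth_eq_depth_parent_add_one ha
  have hdx := T.depth_eq_depth_parent_add_one hr
  rw [h] at hda
  omega

end ContractInsertAbove

open Classical in
/-- The tree with a special vertex obtained from `T` by inserting the special vertex, as the new
root, between the root and its child `c`. -/
def insertRoot (T : RTree α) (c : α) : RTree (Option α) :=
  ofRank none
    (fun o => o.elim none fun a => if a = c ∨ a = T.root then none else some (T.parent a))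
    rfl
    (fun o => o.elim 0 fun a => T.depth a + 1)
    (by
      rintro (_ | a) ha
      · exact absurd rfl ha
      · by_cases h : a = c ∨ a = T.root
        · simp [h]
        · simp [h, T.depth_eq_depth_parent_add_one (not_or.1 h).2])

@[simp] theorem insertRoot_parent_none (T : RTree α) (c : α) :
    (T.insertRoot c).parent none = none := rfl

theorem insertRoot_parent_some (T : RTree α) {c a : α} (h : a = c ∨ a = T.root) :
    (T.insertRoot c).parent (some a) = none := if_pos h

theorem insertRoot_parent_some_of_not (T : RTree α) {c a : α} (h : ¬(a = c ∨ a = T.root)) :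
    (T.insertRoot c).parent (some a) = some (T.parent a) := if_neg h

theorem isSpecialEdge_insertRoot_iff {T : RTree α} {c x : α} :
    IsSpecialEdge (T.insertRoot c) x ↔ x = c ∨ x = T.root := by
  rw [isSpecialEdge_iff, insertRoot_parent_none]
  by_cases h : x = c ∨ x = T.root
  · simp [insertRoot_parent_some T h, h]
  · simp [insertRoot_parent_some_of_not T h, h]

theorem contract_insertRoot_root (T : RTree α) {c : α} (hc : T.parent c = T.root) :
    (T.insertRoot c).contract (isSpecialEdge_insertRoot_iff.2 (Or.inr rfl)) = T := by
  refine ext_of_parent (funext fun a => ?_)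
  by_cases ha : a = T.root
  · subst ha
    rw [contract_parent_of_parent_some (insertRoot_parent_some T (Or.inr rfl)),
      insertRoot_parent_none, collapse_none, T.parent_root]
  rw [contract_parent_of_ne _ ha]
  by_cases hac : a = c
  · rw [insertRoot_parent_some T (Or.inl hac), collapse_none, hac, hc]
  · rw [insertRoot_parent_some_of_not T (not_or.2 ⟨hac, ha⟩), collapse_some]

/-- The tree obtained from `T` by moving the root to its child `c`. -/
def moveRoot (T : RTree α) (c : α) : RTree α :=
  (T.insertRoot c).contract (isSpecialEdge_insertRoot_iff.2 (Or.inl rfl))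

theorem moveRoot_parent_of_ne (T : RTree α) {c a : α} (hac : a ≠ c) (ha : a ≠ T.root) :
    (T.moveRoot c).parent a = T.parent a := by
  rw [moveRoot, contract_parent_of_ne _ hac, insertRoot_parent_some_of_not T (not_or.2 ⟨hac, ha⟩),
    collapse_some]

theorem depth_moveRoot_le (T : RTree α) {c : α} (hc : c ≠ T.root) {j : ℕ} {a : α}
    (h : T.parent^[j] a = c) : (T.moveRoot c).depth a ≤ j := by
  induction j generalizing a with
  | zero => exact ((T.moveRoot c).depth_eq_zero_iff.2 h).le
  | succ j ih =>
    by_cases hac : a = c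
    · exact ((T.moveRoot c).depth_eq_zero_iff.2 hac).le.trans (Nat.zero_le _)
    have ha : a ≠ T.root := by
      rintro rfl
      exact hc (h.symm.trans (Function.iterate_fixed T.parent_root _))
    rw [depth_eq_depth_parent_add_one _ (show a ≠ (T.moveRoot c).root from hac),
      moveRoot_parent_of_ne T hac ha]
    exact Nat.succ_le_succ (ih h)

namespace IsBalanced

variable [Fintype α] {M : Type*} [AddCommGroup M] {f : RTree α → M} (hf : IsBalanced f)
include hf

/-- Balance at `T.insertAbove p` writes `f T` as a combination of values on trees in which no vertex
has moved closer to the root and some vertex has moved away from it. -/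
theorem eq_zero_of_contract_insertAbove (T : RTree α) {a b : α} (hab : a ≠ b)
    (ha : a ≠ T.root) (hb : b ≠ T.root) (h : T.parent a = T.parent b)
    (h0 : ∀ (x : α) (hx : IsSpecialEdge (T.insertAbove (T.parent x)) x), x ≠ T.root →
      T.parent x = T.parent a → f ((T.insertAbove (T.parent x)).contract hx) = 0) : f T = 0 := by
  classical
  have hsp : IsSpecialEdge (T.insertAbove (T.parent a)) (T.parent a) :=
    isSpecialEdge_insertAbove_iff.2 (Or.inr rfl)
  have hbal := hf (T.insertAbove (T.parent a)) (two_le_arity (a := some a) (b := some b)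
    (by simpa using hab) ⟨by simp, insertAbove_parent_some T rfl ha⟩
    ⟨by simp, insertAbove_parent_some T h.symm hb⟩)
  rw [Fintype.sum_eq_single ⟨_, hsp⟩, contract_insertAbove, sign_of_parent_none rfl] at hbal
  · simpa using hbal
  · rintro ⟨x, hx⟩ hne
    obtain ⟨hxa, hxr⟩ | rfl := isSpecialEdge_insertAbove_iff.1 hx
    · have := h0 x (hxa ▸ hx) hxr hxa
      simp only [hxa] at this
      rw [this, smul_zero]
    · exact absurd rfl hne

theorem eq_zero_of_root_eq {z : α}
    (h : ∀ T : RTree α, T.root = z → T.IsLadder → f T = 0) (T : RTree α) (hT : T.root = z) :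
    f T = 0 := by
  have wf : WellFounded fun S T : RTree α => ∑ a, T.depth a < ∑ a, S.depth a :=
    have : IsTrans (RTree α) fun S T => ∑ a, T.depth a < ∑ a, S.depth a :=
      ⟨fun _ _ _ h₁ h₂ => h₂.trans h₁⟩
    have : Std.Irrefl fun S T : RTree α => ∑ a, T.depth a < ∑ a, S.depth a :=
      ⟨fun _ => lt_irrefl _⟩
    Finite.wellFounded_of_trans_of_irrefl _
  induction T using wf.induction with
  | _ T ih =>
    by_cases hl : T.IsLadder
    · exact h T hT hl
    unfold IsLadder at hl
    push Not at hl
    obtain ⟨a, b, ha, hb, hp, hab⟩ := hl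
    refine hf.eq_zero_of_contract_insertAbove T hab ha hb hp fun x hx hxr hxa => ?_
    refine ih _ (Finset.sum_lt_sum
      (fun y _ => depth_le_depth_contract_insertAbove hx hxr y) ?_) hT
    by_cases hax : a = x
    · exact ⟨b, Finset.mem_univ b, depth_lt_depth_contract_insertAbove hx hxr hb
        (fun h => hab (hax.trans h.symm)) (hp.symm.trans hxa.symm)⟩
    · exact ⟨a, Finset.mem_univ a, depth_lt_depth_contract_insertAbove hx hxr ha hax hxa.symm⟩

theorem eq_neg_moveRoot (T : RTree α) {c : α} (hc : T.parent c = T.root) (hcr : c ≠ T.root) :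
    f T = -f (T.moveRoot c) := by
  classical
  have hleaf : (T.insertRoot c).parent (some c) = none := insertRoot_parent_some T (Or.inl rfl)
  have hroot : (T.insertRoot c).parent (some T.root) = none :=
    insertRoot_parent_some T (Or.inr rfl)
  have hbal := hf (T.insertRoot c) (two_le_arity (a := some c) (b := some T.root)
    (by simpa using hcr) ⟨by simp, hleaf⟩ ⟨by simp, hroot⟩)
  rw [Fintype.sum_eq_add ⟨c, isSpecialEdge_insertRoot_iff.2 (Or.inl rfl)⟩
      ⟨T.root, isSpecialEdge_insertRoot_iff.2 (Or.inr rfl)⟩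
      (fun h => hcr (congrArg Subtype.val h)),
    contract_insertRoot_root T hc, sign_of_parent_some hleaf, sign_of_parent_some hroot, one_smul,
    one_smul] at hbal
  · exact eq_neg_of_add_eq_zero_right hbal
  · rintro ⟨x, hx⟩ ⟨hxc, hxr⟩
    rcases isSpecialEdge_insertRoot_iff.1 hx with rfl | rfl
    exacts [absurd rfl hxc, absurd rfl hxr]

theorem eq_zero_of_isLadder (z : α)
    (h : ∀ T : RTree α, T.root = z → T.IsLadder → f T = 0) (T : RTree α) : f T = 0 := by
  induction hd : T.depth z using Nat.strong_induction_on generalizing T with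
  | _ d ih =>
    obtain rfl | d := d
    · exact hf.eq_zero_of_root_eq h T (T.depth_eq_zero_iff.1 hd).symm
    have hroot : T.parent^[d + 1] z = T.root := hd ▸ T.parent_iterate_depth z
    have hcr : T.parent^[d] z ≠ T.root := fun h' => by
      have := T.depth_le_of_parent_iterate h'
      omega
    rw [hf.eq_neg_moveRoot T (by rw [← hroot, Function.iterate_succ_apply']) hcr,
      ih _ (Nat.lt_succ_of_le (T.depth_moveRoot_le hcr rfl)) _ rfl, neg_zero]

end IsBalanced

/-! ### Coefficients of iterated brackets -/

/-- A tree is increasing with respect to a ranking of its vertices if every vertex has at most one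
neighbour of smaller rank: for an injective ranking, the ranks increase along the paths which start
at the vertex of smallest rank, which need not be the root. -/
def IsIncreasing (ρ : α → ℕ) (T : RTree α) : Prop :=
  ∀ i j l, T.Adj i j → T.Adj i l → ρ j < ρ i → ρ l < ρ i → j = l

/-- The sign of the outgoing edge of `i`: it is `-1` if this edge points towards the larger rank. -/
def edgeSign (ρ : α → ℕ) (T : RTree α) (i : α) : ℤ := if ρ i < ρ (T.parent i) then -1 else 1

open Classical in
/-- The coefficient of the tree `T` in the iterated bracket `[…[[v₀, v₁], v₂], …]` (with respect to
the commutator of the pre-Lie product) of its vertices, listed by increasing rank. -/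
def bracketCoeff [Fintype α] (ρ : α → ℕ) (T : RTree α) : ℤ :=
  if IsIncreasing ρ T then ∏ i, edgeSign ρ T i else 0

theorem bracketCoeff_of_isIncreasing [Fintype α] {ρ : α → ℕ} {T : RTree α}
    (h : IsIncreasing ρ T) : bracketCoeff ρ T = ∏ i, edgeSign ρ T i := if_pos h

theorem bracketCoeff_of_not [Fintype α] {ρ : α → ℕ} {T : RTree α} (h : ¬IsIncreasing ρ T) :
    bracketCoeff ρ T = 0 := if_neg h

theorem bracketCoeff_relabel [Fintype α] [Fintype β] (e : α ≃ β) (ρ : β → ℕ) (T : RTree α) :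
    bracketCoeff ρ (T.relabel e) = bracketCoeff (ρ ∘ e) T := by
  have isIncreasing_relabel : IsIncreasing ρ (T.relabel e) ↔ IsIncreasing (ρ ∘ e) T := by
    unfold IsIncreasing
    simp only [← e.forall_congr_right (q := fun _ => _), adj_relabel, e.apply_eq_iff_eq,
      Function.comp_apply]
  have prod_edgeSign_relabel : ∏ i, edgeSign ρ (T.relabel e) i = ∏ i, edgeSign (ρ ∘ e) T i :=
    (Fintype.prod_equiv e _ _ fun i => by simp [edgeSign]).symm
  unfold bracketCoeff
  rw [isIncreasing_relabel, prod_edgeSign_relabel]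

theorem bracketCoeff_strictMono_comp [Fintype α] {f : ℕ → ℕ} (hf : StrictMono f) (ρ : α → ℕ)
    (T : RTree α) : bracketCoeff (f ∘ ρ) T = bracketCoeff ρ T := by
  have isIncreasing_iff : IsIncreasing (f ∘ ρ) T ↔ IsIncreasing ρ T := by
    simp only [IsIncreasing, Function.comp_apply, hf.lt_iff_lt]
  have prod_edgeSign : ∏ i, edgeSign (f ∘ ρ) T i = ∏ i, edgeSign ρ T i :=
    Finset.prod_congr rfl fun i _ => if_congr hf.lt_iff_lt rfl rfl
  unfold bracketCoeff
  rw [isIncreasing_iff, prod_edgeSign]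

section Contract

variable {S : RTree (Option α)} {ρ : Option α → ℕ} (hρ : Function.Injective ρ) {x : α}
  (hx : IsSpecialEdge S x)
  (h : ∀ y, IsSpecialEdge S y → y ≠ x → (ρ (some y) < ρ none ↔ ρ (some y) < ρ (some x)))
include hρ h

theorem none_lt_iff_of_lt_none_iff {y : α} (hy : IsSpecialEdge S y) (hyx : y ≠ x) :
    ρ none < ρ (some y) ↔ ρ (some x) < ρ (some y) := by
  have := h y hy hyx
  have := hρ.ne (Option.some_ne_none y)
  have := hρ.ne (mt Option.some_inj.1 hyx)
  omega

theorem sign_mul_prod_edgeSign_contract [Fintype α] :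
    sign (S, x) * ∏ a, edgeSign (ρ ∘ some) (S.contract hx) a =
      (if ρ (some x) < ρ none then -1 else 1) * ∏ o, edgeSign ρ S o := by
  classical
  have edgeSign_of_ne : ∀ a, a ≠ x →
      edgeSign (ρ ∘ some) (S.contract hx) a = edgeSign ρ S (some a) := by
    intro a ha
    unfold edgeSign
    rw [contract_parent_of_ne hx ha]
    rcases hp : S.parent (some a) with _ | b
    · exact if_congr (h a (isSpecialEdge_iff.2 (Or.inl hp)) ha).symm rfl rfl
    · rfl
  rw [Fintype.prod_option, ← Finset.mul_prod_erase _ _ (Finset.mem_univ x),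
    ← Finset.mul_prod_erase _ (fun a => edgeSign ρ S (some a)) (Finset.mem_univ x),
    Finset.prod_congr rfl fun a ha => edgeSign_of_ne a (Finset.ne_of_mem_erase ha)]
  simp only [← mul_assoc]
  congr 1
  have hne := hρ.ne (Option.some_ne_none x)
  unfold edgeSign
  rcases isSpecialEdge_iff.1 hx with hp | hp
  · rw [sign_of_parent_some hp, contract_parent_of_parent_some hp, hp]
    rcases hq : S.parent none with _ | b
    · by_cases hlt : ρ (some x) < ρ none <;> simp [hlt]
    · have hb : b ≠ x := by
        rintro rfl
        exact parent_some_ne_none hq hp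
      have := none_lt_iff_of_lt_none_iff hρ h (isSpecialEdge_iff.2 (Or.inr hq)) hb
      by_cases hlt : ρ (some x) < ρ none <;> by_cases hb : ρ (some x) < ρ (some b) <;>
        simp [hlt, hb, this]
  · rw [sign_of_parent_none hp, contract_parent_of_parent_none hp, hp]
    rcases hq : S.parent (some x) with _ | b
    · exact absurd hq (parent_some_ne_none hp)
    · rcases hne.lt_or_gt with hlt | hlt <;> by_cases hb : ρ (some x) < ρ (some b) <;>
        simp [hlt, hb, hlt.not_gt]

variable {m : α} (hm : IsSpecialEdge S m)
  (hlt : ∀ y, IsSpecialEdge S y → (ρ (some y) < ρ none ↔ y = m))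
include hm hlt

theorem adj_contract_and_lt_iff [DecidableEq α] (a b : α) :
    (S.contract hx).Adj a b ∧ ρ (some b) < ρ (some a) ↔
      ∃ o, S.Adj (some a) o ∧ ρ o < ρ (some a) ∧ collapse (if a = x then m else x) o = b := by
  have adj_none : ∀ {y}, S.Adj (some y) none ↔ IsSpecialEdge S y := Iff.rfl
  rw [adj_contract, Option.exists]
  simp only [collapse_none, collapse_some, adj_none]
  have hm_lt := (hlt m hm).2 rfl
  constructor
  · rintro ⟨⟨hab, hadj | ⟨rfl, hb⟩ | ⟨rfl, ha⟩⟩, hba⟩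
    · exact Or.inr ⟨b, hadj, hba, rfl⟩
    · have hbm := (hlt b hb).1 ((h b hb hab.symm).2 hba)
      have hx_lt : ¬ρ (some a) < ρ none := fun h' => hab (((hlt a hx).1 h').trans hbm.symm)
      have := hρ.ne (Option.some_ne_none a)
      exact Or.inl ⟨hx, by omega, by rw [if_pos rfl, hbm]⟩
    · exact Or.inl ⟨ha, (none_lt_iff_of_lt_none_iff hρ h ha hab).2 hba, if_neg hab⟩
  · rintro (⟨ha, halt, rfl⟩ | ⟨b, hadj, hba, rfl⟩)
    · by_cases hax : a = x
      · subst hax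
        rw [if_pos rfl]
        have hma : ρ (some m) < ρ (some a) := hm_lt.trans halt
        exact ⟨⟨fun h' => hma.ne (h' ▸ rfl), Or.inr (Or.inl ⟨rfl, hm⟩)⟩, hma⟩
      · rw [if_neg hax]
        exact ⟨⟨hax, Or.inr (Or.inr ⟨rfl, ha⟩)⟩, (none_lt_iff_of_lt_none_iff hρ h ha hax).1 halt⟩
    · exact ⟨⟨fun h' => hba.ne (h' ▸ rfl), Or.inl hadj⟩, hba⟩

theorem isIncreasing_contract_iff :
    IsIncreasing (ρ ∘ some) (S.contract hx) ↔ IsIncreasing ρ S := by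
  classical
  have lower_iff := adj_contract_and_lt_iff hρ hx h hm hlt
  constructor
  · rintro hinc (_ | a) j l hj hl hjlt hllt
    · rcases j with _ | j
      · exact absurd rfl hj.ne
      rcases l with _ | l
      · exact absurd rfl hl.ne
      rw [(hlt j hj.symm).1 hjlt, (hlt l hl.symm).1 hllt]
    · have hj' := (lower_iff a _).2 ⟨j, hj, hjlt, rfl⟩
      have hl' := (lower_iff a _).2 ⟨l, hl, hllt, rfl⟩
      have heq := hinc a _ _ hj'.1 hl'.1 hj'.2 hl'.2
      have hz : IsSpecialEdge S (if a = x then m else x) := by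
        split_ifs
        exacts [hm, hx]
      rcases j with _ | j <;> rcases l with _ | l
      · rfl
      · rw [collapse_none, collapse_some] at heq
        exact absurd (heq ▸ hz.adj) (hj.not_adj hl)
      · rw [collapse_none, collapse_some] at heq
        exact absurd (heq ▸ hz.adj) (hl.not_adj hj)
      · exact congrArg some heq
  · intro hinc a b c hb hc hblt hclt
    obtain ⟨o, ho, hoa, rfl⟩ := (lower_iff a b).1 ⟨hb, hblt⟩
    obtain ⟨o', ho', ho'a, rfl⟩ := (lower_iff a c).1 ⟨hc, hclt⟩
    rw [hinc _ _ _ ho ho' hoa ho'a]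

theorem sign_mul_bracketCoeff_contract [Fintype α] :
    sign (S, x) * bracketCoeff (ρ ∘ some) (S.contract hx) =
      (if ρ (some x) < ρ none then -1 else 1) * bracketCoeff ρ S := by
  by_cases hS : IsIncreasing ρ S
  · rw [bracketCoeff_of_isIncreasing hS, bracketCoeff_of_isIncreasing
      ((isIncreasing_contract_iff hρ hx h hm hlt).2 hS), sign_mul_prod_edgeSign_contract hρ hx h]
  · rw [bracketCoeff_of_not hS,
      bracketCoeff_of_not (mt (isIncreasing_contract_iff hρ hx h hm hlt).1 hS), mul_zero, mul_zero]

end Contract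

theorem not_isIncreasing_contract {S : RTree (Option α)} {ρ : α → ℕ} {x y z : α}
    (hx : IsSpecialEdge S x) (hy : IsSpecialEdge S y) (hz : IsSpecialEdge S z) (hyz : y ≠ z)
    (hyx : ρ y < ρ x) (hzx : ρ z < ρ x) : ¬IsIncreasing ρ (S.contract hx) := by
  have adj : ∀ {y}, IsSpecialEdge S y → ρ y < ρ x → (S.contract hx).Adj x y := fun hy h =>
    (adj_contract hx _ _).2 ⟨fun h' => h.ne (h' ▸ rfl), Or.inr (Or.inl ⟨rfl, hy⟩)⟩
  exact fun h => hyz (h x y z (adj hy hyx) (adj hz hzx) hyx hzx)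

theorem exists_two_least_specialEdge [Finite α] {S : RTree (Option α)} (hS : 2 ≤ S.arity none)
    {ρ : α → ℕ} (hρ : Function.Injective ρ) :
    ∃ m₁ m₂, IsSpecialEdge S m₁ ∧ IsSpecialEdge S m₂ ∧ ρ m₁ < ρ m₂ ∧
      ∀ x, IsSpecialEdge S x → x ≠ m₁ → x ≠ m₂ → ρ m₂ < ρ x := by
  obtain ⟨x, y, hxy, hx, hy⟩ := exists_edge_of_two_le_arity hS
  rcases x with _ | x
  · exact absurd rfl hx.1
  rcases y with _ | y
  · exact absurd rfl hy.1
  obtain ⟨m₁, hm₁, hmin₁⟩ := Set.exists_min_image {z | IsSpecialEdge S z} ρ (Set.toFinite _)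
    ⟨x, Or.inl hx⟩
  have hne : {z | IsSpecialEdge S z ∧ z ≠ m₁}.Nonempty := by
    by_cases h : x = m₁
    · exact ⟨y, Or.inl hy, fun h' => hxy (congrArg some (h.trans h'.symm))⟩
    · exact ⟨x, Or.inl hx, h⟩
  obtain ⟨m₂, hm₂, hmin₂⟩ := Set.exists_min_image _ ρ (Set.toFinite _) hne
  exact ⟨m₁, m₂, hm₁, hm₂.1, (hmin₁ _ hm₂.1).lt_of_ne (hρ.ne hm₂.2.symm),
    fun x hx hx₁ hx₂ => (hmin₂ x ⟨hx, hx₁⟩).lt_of_ne (hρ.ne hx₂.symm)⟩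

/-- Give the special vertex a rank just above that of its least neighbour `m₁`: then both
contractions have, up to opposite signs, the same coefficient as the whole tree. -/
theorem sign_mul_bracketCoeff_contract_add_eq_zero [Fintype α] {S : RTree (Option α)} {ρ : α → ℕ}
    (hρ : Function.Injective ρ) {m₁ m₂ : α} (h₁ : IsSpecialEdge S m₁) (h₂ : IsSpecialEdge S m₂)
    (h₁₂ : ρ m₁ < ρ m₂) (hmin : ∀ x, IsSpecialEdge S x → x ≠ m₁ → x ≠ m₂ → ρ m₂ < ρ x) :
    sign (S, m₁) * bracketCoeff ρ (S.contract h₁) +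
      sign (S, m₂) * bracketCoeff ρ (S.contract h₂) = 0 := by
  classical
  have hmin₁ : ∀ x, IsSpecialEdge S x → x ≠ m₁ → ρ m₁ < ρ x := fun x hx hx₁ =>
    if hx₂ : x = m₂ then hx₂ ▸ h₁₂ else h₁₂.trans (hmin x hx hx₁ hx₂)
  let ρ' : Option α → ℕ := fun o => o.elim (2 * ρ m₁ + 1) fun a => 2 * ρ a
  have hρ' : Function.Injective ρ' := by
    rintro (_ | a) (_ | b) h <;> simp only [ρ', Option.elim_none, Option.elim_some] at h
    · rfl
    · omega
    · omega
    · exact congrArg some (hρ (by omega))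
  have bracketCoeff_ρ' : ∀ T : RTree α, bracketCoeff (ρ' ∘ some) T = bracketCoeff ρ T :=
    bracketCoeff_strictMono_comp (f := (2 * ·)) (strictMono_mul_left_of_pos two_pos) ρ
  have lt_none_iff : ∀ y, IsSpecialEdge S y → (ρ' (some y) < ρ' none ↔ y = m₁) := by
    intro y hy
    change 2 * ρ y < 2 * ρ m₁ + 1 ↔ y = m₁
    refine ⟨fun h => by_contra fun h' => ?_, fun h => h ▸ Nat.lt_succ_self _⟩
    have := hmin₁ y hy h'
    omega
  have coeff₁ : sign (S, m₁) * bracketCoeff ρ (S.contract h₁) = -bracketCoeff ρ' S := by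
    rw [← bracketCoeff_ρ', sign_mul_bracketCoeff_contract hρ' h₁ _ h₁ lt_none_iff, if_pos,
      neg_one_mul]
    · exact (lt_none_iff m₁ h₁).2 rfl
    · intro y hy hy₁
      have := hmin₁ y hy hy₁
      change 2 * ρ y < 2 * ρ m₁ + 1 ↔ 2 * ρ y < 2 * ρ m₁
      omega
  have coeff₂ : sign (S, m₂) * bracketCoeff ρ (S.contract h₂) = bracketCoeff ρ' S := by
    rw [← bracketCoeff_ρ', sign_mul_bracketCoeff_contract hρ' h₂ _ h₁ lt_none_iff, if_neg,
      one_mul]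
    · exact fun h => h₁₂.ne (by rw [(lt_none_iff m₂ h₂).1 h])
    · intro y hy hy₂
      rw [lt_none_iff y hy]
      change y = m₁ ↔ 2 * ρ y < 2 * ρ m₂
      refine ⟨fun h => by rw [h]; omega, fun h => by_contra fun hy₁ => ?_⟩
      have := hmin y hy hy₁ hy₂
      omega
  rw [coeff₁, coeff₂, neg_add_cancel]

theorem isBalanced_bracketCoeff [Fintype α] {ρ : α → ℕ} (hρ : Function.Injective ρ)
    {M : Type*} [AddCommGroup M] (t : M) : IsBalanced fun T : RTree α => bracketCoeff ρ T • t := by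
  classical
  intro S hS
  obtain ⟨m₁, m₂, h₁, h₂, h₁₂, hmin⟩ := exists_two_least_specialEdge hS hρ
  have hne : m₁ ≠ m₂ := fun h => h₁₂.ne (h ▸ rfl)
  rw [Fintype.sum_eq_add ⟨m₁, h₁⟩ ⟨m₂, h₂⟩ (fun h => hne (congrArg Subtype.val h))]
  · rw [smul_smul, smul_smul, ← add_smul,
      sign_mul_bracketCoeff_contract_add_eq_zero hρ h₁ h₂ h₁₂ hmin, zero_smul]
  · rintro ⟨x, hx⟩ ⟨hx₁, hx₂⟩
    have hlt₂ := hmin x hx (fun h => hx₁ (Subtype.ext h)) fun h => hx₂ (Subtype.ext h)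
    simp only [bracketCoeff_of_not (not_isIncreasing_contract hx h₁ h₂ hne (h₁₂.trans hlt₂) hlt₂),
      zero_smul, smul_zero]

/-! ### Values on ladders -/

theorem IsLadder.depth_injective {T : RTree α} (hT : T.IsLadder) : Function.Injective T.depth := by
  intro a b h
  induction hn : T.depth a generalizing a b with
  | zero => exact (T.depth_eq_zero_iff.1 hn).trans (T.depth_eq_zero_iff.1 (h.symm.trans hn)).symm
  | succ n ih =>
    have ha : a ≠ T.root := fun h' => by simp [h'] at hn
    have hb : b ≠ T.root := fun h' => by simp [h', hn] at h
    have hda := T.depth_eq_depth_parent_add_one ha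
    have hdb := T.depth_eq_depth_parent_add_one hb
    exact hT a b ha hb (ih (by omega) (by omega))

theorem bracketCoeff_depth_self [Fintype α] (T : RTree α) : bracketCoeff T.depth T = 1 := by
  have parent_eq_of_adj : ∀ i j, T.Adj i j → T.depth j < T.depth i → T.parent i = j := by
    rintro i j (h | h) hlt
    · exact h.2
    · have := h.depth
      omega
  rw [bracketCoeff_of_isIncreasing fun i j l hj hl hlt hlt' =>
    (parent_eq_of_adj i j hj hlt).symm.trans (parent_eq_of_adj i l hl hlt')]
  refine Finset.prod_eq_one fun i _ => if_neg ?_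
  by_cases hi : i = T.root
  · rw [hi, T.parent_root]
    exact lt_irrefl _
  · have := T.depth_eq_depth_parent_add_one hi
    omega

theorem IsIncreasing.parent_lt {ρ : α → ℕ} (hρ : Function.Injective ρ) {T : RTree α}
    (h : IsIncreasing ρ T) (h0 : ∀ i, ρ T.root ≤ ρ i) {i : α} (hi : i ≠ T.root) :
    ρ (T.parent i) < ρ i := by
  refine T.parent_induction (p := fun i => i ≠ T.root → ρ (T.parent i) < ρ i)
    (fun h => absurd rfl h) (fun i hi ih _ => ?_) i hi
  by_cases hp : T.parent i = T.root
  · exact hp ▸ (h0 i).lt_of_ne (hρ.ne hi.symm)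
  · by_contra hge
    have hlt := (not_lt.1 hge).lt_of_ne (hρ.ne (T.parent_ne_self hi).symm)
    have := h _ _ i (Or.inl (T.edge_parent hp)) (Or.inr (T.edge_parent hi)) (ih hp) hlt
    exact (this ▸ T.edge_parent hp).not_edge (T.edge_parent hi)

theorem bracketCoeff_depth_of_ne [Fintype α] {L T : RTree α} (hL : L.IsLadder) (hT : T.IsLadder)
    (hr : T.root = L.root) (hne : T ≠ L) : bracketCoeff L.depth T = 0 := by
  refine bracketCoeff_of_not fun h => hne ?_
  have depth_parent_lt : ∀ i, i ≠ T.root → L.depth (T.parent i) < L.depth i := fun i hi =>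
    h.parent_lt hL.depth_injective (by rw [hr, L.depth_root]; exact fun i => Nat.zero_le _) hi
  refine ext_of_parent (funext fun i => ?_)
  induction hn : L.depth i using Nat.strong_induction_on generalizing i with
  | _ n ih =>
    by_cases hi : i = T.root
    · rw [hi, T.parent_root, hr, L.parent_root]
    · have hiL : i ≠ L.root := hr ▸ hi
      have h1 := depth_parent_lt i hi
      have h2 := L.depth_eq_depth_parent_add_one hiL
      apply hL.depth_injective
      by_contra hd
      obtain ⟨b, hb⟩ := L.exists_depth_eq i (j := L.depth (T.parent i) + 1) h1
      have hbL : b ≠ L.root := fun h' => by simp [h'] at hb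
      have hpb : L.parent b = T.parent i := by
        have := L.depth_eq_depth_parent_add_one hbL
        exact hL.depth_injective (by omega)
      have hbi : b = i := hT b i (hr ▸ hbL) hi ((ih (L.depth b) (by omega) b rfl).trans hpb)
      subst hbi
      omega

/-! ### Adding a vertex -/

/-- Adding one element to a type, as a leaf or as a root of a tree with vertices in this type. -/
def sumFinOneEquiv (α : Type*) : α ⊕ Fin 1 ≃ Option α :=
  ((Equiv.refl α).sumCongr (Equiv.ofUnique (Fin 1) PUnit.{1})).trans
    (Equiv.optionEquivSumPUnit.{0} α).symm

/-- Adding a new leaf `none`, connected with the vertex `a`. -/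
def addLeaf (T : RTree α) (a : α) : RTree (Option α) :=
  (T.graft a (single (Fin 1))).relabel (sumFinOneEquiv α)

/-- Adding a new root `none`, connected with the old one. -/
def addRoot (T : RTree α) : RTree (Option α) :=
  ((single (Fin 1)).graft 0 T).relabel ((Equiv.sumComm _ _).trans (sumFinOneEquiv α))

@[simp] theorem addLeaf_root (T : RTree α) (a : α) : (T.addLeaf a).root = some T.root := rfl

@[simp] theorem addLeaf_parent_some (T : RTree α) (a y : α) :
    (T.addLeaf a).parent (some y) = some (T.parent y) := rfl

@[simp] theorem addLeaf_parent_none (T : RTree α) (a : α) :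
    (T.addLeaf a).parent none = some a := by
  have : (default : Fin 1) = (single (Fin 1)).root := rfl
  simp [addLeaf, sumFinOneEquiv, this]

@[simp] theorem addRoot_root (T : RTree α) : T.addRoot.root = none := rfl

@[simp] theorem addRoot_parent_none (T : RTree α) : T.addRoot.parent none = none := rfl

theorem addRoot_parent_some (T : RTree α) {y : α} (hy : y ≠ T.root) :
    T.addRoot.parent (some y) = some (T.parent y) := by
  simp [addRoot, sumFinOneEquiv, hy]

@[simp] theorem addRoot_parent_root (T : RTree α) : T.addRoot.parent (some T.root) = none := by
  simp [addRoot, sumFinOneEquiv]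

theorem edge_addRoot (T : RTree α) (x y : α) :
    T.addRoot.Edge (some x) (some y) ↔ T.Edge x y := by
  by_cases hx : x = T.root
  · subst hx
    simp [Edge, T.parent_root]
  · simp [Edge, addRoot_parent_some _ hx]

theorem adj_addLeaf (T : RTree α) (a x y : α) :
    (T.addLeaf a).Adj (some x) (some y) ↔ T.Adj x y := by
  simp [Adj, Edge]

theorem adj_addLeaf_none (T : RTree α) (a : α) (o : Option α) :
    (T.addLeaf a).Adj none o ↔ o = some a := by
  cases o <;> simp [Adj, Edge, eq_comm]

theorem adj_addRoot (T : RTree α) (x y : α) :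
    T.addRoot.Adj (some x) (some y) ↔ T.Adj x y :=
  or_congr (T.edge_addRoot x y) (T.edge_addRoot y x)

theorem adj_addRoot_none (T : RTree α) (o : Option α) :
    T.addRoot.Adj none o ↔ o = some T.root := by
  rcases o with _ | x
  · simp [Adj, Edge]
  · by_cases hx : x = T.root
    · subst hx
      simp [Adj, Edge]
    · simp [Adj, Edge, addRoot_parent_some _ hx, hx]

theorem addLeaf_inj {S T : RTree α} {a b : α} : S.addLeaf a = T.addLeaf b ↔ S = T ∧ a = b := by
  refine ⟨fun h => ⟨ext_of_parent (funext fun y => ?_), ?_⟩, fun ⟨hS, ha⟩ => hS ▸ ha ▸ rfl⟩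
  · simpa using congrArg (fun R => R.parent (some y)) h
  · simpa using congrArg (fun R => R.parent none) h

theorem addRoot_injective : Function.Injective (addRoot (α := α)) := fun S T h =>
  ext_of_edge fun a b => by rw [← edge_addRoot, h, edge_addRoot]

theorem exists_parent_eq_root [Nontrivial α] (T : RTree α) :
    ∃ a, a ≠ T.root ∧ T.parent a = T.root := by
  obtain ⟨y, hy⟩ := exists_ne T.root
  have hd := T.depth_eq_depth_parent_add_one hy
  obtain ⟨a, ha⟩ := T.exists_depth_eq y (j := 1) (by omega)
  have har : a ≠ T.root := fun h => by simp [h] at ha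
  have hda := T.depth_eq_depth_parent_add_one har
  exact ⟨a, har, T.depth_eq_zero_iff.1 (by omega)⟩

theorem exists_eq_addRoot [Nonempty α] {T : RTree (Option α)}
    (h : ∀ o o', T.Adj none o → T.Adj none o' → o = o') (hp : T.parent none = none) :
    ∃ S : RTree α, T = S.addRoot := by
  have hr : T.root = none := (T.parent_eq_self_iff.1 hp).symm
  obtain ⟨_ | c, hcr, hc⟩ := T.exists_parent_eq_root
  · exact absurd hr.symm hcr
  rw [hr] at hc
  have hsp : IsSpecialEdge T c := isSpecialEdge_iff.2 (Or.inl hc)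
  have root_contract : (T.contract hsp).root = c := by rw [contract_root, hr, collapse_none]
  refine ⟨T.contract hsp, ext_of_parent (funext ?_)⟩
  rintro (_ | z)
  · exact hp
  · by_cases hz : z = c
    · rw [hz, hc]
      nth_rw 2 [← root_contract]
      rw [addRoot_parent_root]
    · rw [addRoot_parent_some _ (by rwa [root_contract]), contract_parent_of_ne hsp hz]
      rcases hq : T.parent (some z) with _ | q
      · exact absurd (Option.some.inj (h (some z) (some c) (Or.inr ⟨by simp, hq⟩) hsp.adj)) hz
      · rfl

theorem exists_eq_addLeaf {T : RTree (Option α)}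
    (h : ∀ o o', T.Adj none o → T.Adj none o' → o = o') {p : α} (hp : T.parent none = some p) :
    ∃ S : RTree α, T = S.addLeaf p := by
  have hsp : IsSpecialEdge T p := isSpecialEdge_iff.2 (Or.inr hp)
  refine ⟨T.contract hsp, ext_of_parent (funext ?_)⟩
  rintro (_ | z)
  · rw [hp, addLeaf_parent_none]
  · rw [addLeaf_parent_some, contract_parent_of_parent_none hp]
    rcases hq : T.parent (some z) with _ | q
    · have hz : some z = some p := h _ _ (Or.inr ⟨by simp, hq⟩) hsp.adj
      exact absurd (hz ▸ hq) (parent_some_ne_none hp)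
    · rfl

/-- The tree obtained by adding a vertex to a tree: as a leaf connected with `a` if the second
argument is `some a`, and as the new root if it is `none`. -/
def addVertex (p : RTree α × Option α) : RTree (Option α) := p.2.elim p.1.addRoot p.1.addLeaf

theorem addVertex_injective : Function.Injective (addVertex (α := α)) := by
  rintro ⟨S, _ | a⟩ ⟨T, _ | b⟩ h
  · exact congrArg (·, none) (addRoot_injective h)
  · exact absurd (congrArg root h) (by simp [addVertex])
  · exact absurd (congrArg root h) (by simp [addVertex])
  · obtain ⟨rfl, rfl⟩ := addLeaf_inj.1 h
    rfl

theorem exists_addVertex_eq [Nonempty α] {T : RTree (Option α)}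
    (h : ∀ o o', T.Adj none o → T.Adj none o' → o = o') : ∃ p, addVertex p = T := by
  rcases hp : T.parent none with _ | a
  · obtain ⟨S, rfl⟩ := exists_eq_addRoot h hp
    exact ⟨(S, none), rfl⟩
  · obtain ⟨S, rfl⟩ := exists_eq_addLeaf h hp
    exact ⟨(S, some a), rfl⟩

section BracketCoeff

variable {ρ : Option α → ℕ} (hρ : ∀ x, ρ (some x) < ρ none)
include hρ

theorem isIncreasing_option {T : RTree α} {T' : RTree (Option α)}
    (adj_some : ∀ x y, T'.Adj (some x) (some y) ↔ T.Adj x y) {a : α}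
    (adj_none : ∀ o, T'.Adj none o ↔ o = some a) :
    IsIncreasing ρ T' ↔ IsIncreasing (ρ ∘ some) T := by
  constructor
  · intro h x y z hy hz hyx hzx
    exact Option.some.inj (h _ _ _ ((adj_some _ _).2 hy) ((adj_some _ _).2 hz) hyx hzx)
  · rintro h (_ | x) j l hj hl hjlt hllt
    · rw [(adj_none j).1 hj, (adj_none l).1 hl]
    · rcases j with _ | j
      · exact absurd (hρ x) hjlt.not_gt
      rcases l with _ | l
      · exact absurd (hρ x) hllt.not_gt
      exact congrArg some (h x j l ((adj_some _ _).1 hj) ((adj_some _ _).1 hl) hjlt hllt)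

variable [Fintype α]

theorem bracketCoeff_addLeaf (T : RTree α) (a : α) :
    bracketCoeff ρ (T.addLeaf a) = bracketCoeff (ρ ∘ some) T := by
  have edgeSign_none : edgeSign ρ (T.addLeaf a) none = 1 := by simp [edgeSign, (hρ a).le]
  have prod_edgeSign : ∏ o, edgeSign ρ (T.addLeaf a) o = ∏ x, edgeSign (ρ ∘ some) T x := by
    rw [Fintype.prod_option, edgeSign_none, one_mul]
    rfl
  unfold bracketCoeff
  rw [isIncreasing_option hρ (T.adj_addLeaf a) (T.adj_addLeaf_none a), prod_edgeSign]

theorem bracketCoeff_addRoot (T : RTree α) :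
    bracketCoeff ρ T.addRoot = -bracketCoeff (ρ ∘ some) T := by
  classical
  have edgeSign_none : edgeSign ρ T.addRoot none = 1 := by simp [edgeSign]
  have edgeSign_some_root : edgeSign ρ T.addRoot (some T.root) = -1 := by simp [edgeSign, hρ]
  have edgeSign_root : edgeSign (ρ ∘ some) T T.root = 1 := by simp [edgeSign, T.parent_root]
  have edgeSign_of_ne : ∀ y ∈ Finset.univ.erase T.root,
      edgeSign ρ T.addRoot (some y) = edgeSign (ρ ∘ some) T y := fun y hy => by
    rw [edgeSign, addRoot_parent_some _ (Finset.ne_of_mem_erase hy)]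
    rfl
  have prod_edgeSign : ∏ o, edgeSign ρ T.addRoot o = -∏ x, edgeSign (ρ ∘ some) T x := by
    rw [Fintype.prod_option, ← Finset.mul_prod_erase _ _ (Finset.mem_univ T.root),
      ← Finset.mul_prod_erase _ (edgeSign (ρ ∘ some) T) (Finset.mem_univ T.root), edgeSign_none,
      edgeSign_some_root, edgeSign_root, Finset.prod_congr rfl edgeSign_of_ne]
    ring
  unfold bracketCoeff
  rw [isIncreasing_option hρ T.adj_addRoot T.adj_addRoot_none, prod_edgeSign]
  split_ifs
  exacts [rfl, neg_zero.symm]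

theorem exists_addVertex_eq_of_bracketCoeff_ne_zero [Nonempty α] {T : RTree (Option α)}
    (h : bracketCoeff ρ T ≠ 0) : ∃ p, addVertex p = T := by
  have hT : IsIncreasing ρ T := by_contra fun h' => h (bracketCoeff_of_not h')
  have lt_of_adj : ∀ o, T.Adj none o → ρ o < ρ none := by
    rintro (_ | x) h
    · exact absurd rfl h.ne
    · exact hρ x
  exact exists_addVertex_eq fun o o' ho ho' =>
    hT none o o' ho ho' (lt_of_adj o ho) (lt_of_adj o' ho')

theorem sum_bracketCoeff_smul_option [Nonempty α] {M : Type*} [AddCommGroup M]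
    (g : RTree (Option α) → M) :
    ∑ T, bracketCoeff ρ T • g T =
      ∑ T : RTree α, bracketCoeff (ρ ∘ some) T • (∑ a, g (T.addLeaf a) - g T.addRoot) := by
  classical
  have sum_addVertex : ∑ p : RTree α × Option α, bracketCoeff ρ (addVertex p) • g (addVertex p) =
      ∑ T, bracketCoeff ρ T • g T := by
    refine Finset.sum_of_injOn addVertex addVertex_injective.injOn (fun _ _ => Finset.mem_univ _)
      (fun T _ hT => ?_) fun _ _ => rfl
    by_cases h : bracketCoeff ρ T = 0
    · rw [h, zero_smul]
    · obtain ⟨p, hp⟩ := exists_addVertex_eq_of_bracketCoeff_ne_zero hρ h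
      exact absurd ⟨p, by simp, hp⟩ hT
  rw [← sum_addVertex, Fintype.sum_prod_type]
  refine Finset.sum_congr rfl fun T _ => ?_
  rw [Fintype.sum_option]
  simp only [addVertex, Option.elim_none, Option.elim_some, bracketCoeff_addRoot hρ,
    bracketCoeff_addLeaf hρ, smul_sub, Finset.smul_sum, neg_smul]
  abel

end BracketCoeff

variable {γ : Type*}

theorem graft_graft_inr (T : RTree α) (S : RTree β) (R : RTree γ) (a : α) (b : β) :
    ((T.graft a S).graft (Sum.inr b) R).relabel (Equiv.sumAssoc α β γ) =
      T.graft a (S.graft b R) := by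
  refine ext_of_parent (funext ?_)
  rintro (x | y | z)
  · simp
  · by_cases h : y = S.root <;> simp [h]
  · by_cases h : z = R.root <;> simp [h]

/-- The associativity of disjoint unions, combined with a transposition. It compares the two orders
in which two trees can be grafted onto a third one. -/
def sumRightComm (α β γ : Type*) : (α ⊕ β) ⊕ γ ≃ (α ⊕ γ) ⊕ β :=
  ((Equiv.sumAssoc α β γ).trans (Equiv.sumCongr (Equiv.refl α) (Equiv.sumComm β γ))).trans
    (Equiv.sumAssoc α γ β).symm

theorem graft_graft_inl (T : RTree α) (S : RTree β) (R : RTree γ) (a b : α) :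
    ((T.graft a S).graft (Sum.inl b) R).relabel (sumRightComm α β γ) =
      (T.graft b R).graft (Sum.inl a) S := by
  refine ext_of_parent (funext ?_)
  rintro ((x | z) | y)
  · simp [sumRightComm]
  · by_cases h : z = R.root <;> simp [sumRightComm, h]
  · by_cases h : y = S.root <;> simp [sumRightComm, h]

end RTree

/-! ### Trees decorated by vectors -/

namespace Tr

variable {k : Type*} [CommRing k] {V W : Type*} [AddCommGroup V] [Module k V]
  [AddCommGroup W] [Module k W]

variable (k V) in
/-- The class in `Tr(V)` of an element of `Span(Trₙ) ⊗ V^{⊗ n}`. -/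
def mk (n : ℕ) : SpanTensor k V n (RTree (Fin n)) →ₗ[k] Tr k V :=
  DirectSum.lof k ℕ (fun n => Decorated k V n (RTree (Fin n))) n ∘ₗ
    Decorated.mk k V n (RTree (Fin n))

theorem mk_single {n : ℕ} (T : RTree (Fin n)) (w : Fin n → V) :
    mk k V n (Finsupp.single T (PiTensorProduct.tprod k w)) = of k T w := rfl

theorem mk_diag {n : ℕ} (σ : Equiv.Perm (Fin n)) (z : SpanTensor k V n (RTree (Fin n))) :
    mk k V n (diag k V n _ σ z) = mk k V n z :=
  congrArg (DirectSum.lof k ℕ (fun n => Decorated k V n (RTree (Fin n))) n)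
    (Decorated.mk_diag k V n _ σ z)

theorem induction_mk {p : Tr k V → Prop} (mk : ∀ n z, p (mk k V n z))
    (add : ∀ x y, p x → p y → p (x + y)) (x : Tr k V) : p x := by
  induction x using DirectSum.induction_on with
  | zero => simpa using mk 0 0
  | of n z =>
    obtain ⟨z, rfl⟩ := Decorated.mk_surjective k V n _ z
    exact mk n z
  | add x y hx hy => exact add x y hx hy

theorem induction {p : Tr k V → Prop} (zero : p 0) (add : ∀ x y, p x → p y → p (x + y))
    (smul : ∀ (r : k) x, p x → p (r • x))
    (of : ∀ (n : ℕ) (T : RTree (Fin n)) (w : Fin n → V), p (of k T w)) (x : Tr k V) : p x := by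
  refine induction_mk (fun n z => ?_) add x
  induction z using Finsupp.induction_linear with
  | zero => rwa [map_zero]
  | add a b ha hb =>
    rw [map_add]
    exact add _ _ ha hb
  | single T t =>
    induction t using PiTensorProduct.induction_on with
    | add a b ha hb =>
      rw [Finsupp.single_add, map_add]
      exact add _ _ ha hb
    | smul_tprod r w =>
      rw [← Finsupp.smul_single, map_smul, mk_single]
      exact smul _ _ (of n T w)

theorem of_relabel {m n : ℕ} (e : Fin m ≃ Fin n) (T : RTree (Fin m)) (w : Fin m → V) :
    of k (T.relabel e) (w ∘ e.symm) = of k T w := by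
  obtain rfl : m = n := by simpa using Fintype.card_congr e
  have h := mk_diag e (Finsupp.single T (PiTensorProduct.tprod k w))
  rwa [diag_single, permTensor_tprod] at h

variable (k) in
/-- The tree `T` decorated by `w`, for an arbitrary finite set of vertices in place of
`{1, …, n}`. -/
def decorate {α : Type*} [Fintype α] (T : RTree α) (w : α → V) : Tr k V :=
  of k (T.relabel (Fintype.equivFin α)) (w ∘ (Fintype.equivFin α).symm)

variable {α β γ : Type*} [Fintype α] [Fintype β] [Fintype γ]

theorem decorate_eq_of {n : ℕ} (e : α ≃ Fin n) (T : RTree α) (w : α → V) :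
    decorate k T w = of k (T.relabel e) (w ∘ e.symm) := by
  rw [decorate, ← of_relabel ((Fintype.equivFin α).symm.trans e), RTree.relabel_relabel,
    ← Equiv.trans_assoc, Equiv.self_trans_symm, Equiv.refl_trans]
  congr 1
  funext x
  simp

theorem decorate_fin {n : ℕ} (T : RTree (Fin n)) (w : Fin n → V) : decorate k T w = of k T w := by
  rw [decorate_eq_of (Equiv.refl _), RTree.relabel_refl]
  rfl

theorem decorate_relabel (e : α ≃ β) (T : RTree α) (w : β → V) :
    decorate k (T.relabel e) w = decorate k T (w ∘ e) := by
  rw [decorate_eq_of (Fintype.equivFin β), decorate_eq_of (e.trans (Fintype.equivFin β)),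
    RTree.relabel_relabel]
  congr 1
  funext x
  simp

theorem star_of {m n : ℕ} (T : RTree (Fin m)) (S : RTree (Fin n)) (w : Fin m → V)
    (u : Fin n → V) :
    star k V (of k T w) (of k S u) = ∑ a, decorate k (T.graft a S) (Sum.elim w u) := by
  simp only [star, of, DirectSum.toModule_lof, LinearMap.flip_apply, LinearMap.compr₂_apply,
    starHom, Decorated.of, Decorated.lift_mk, starTensor_single, map_sum, concat_tprod]
  refine Finset.sum_congr rfl fun a _ => ?_
  rw [decorate_eq_of finSumFinEquiv]
  rfl

theorem star_decorate (T : RTree α) (S : RTree β) (w : α → V) (u : β → V) :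
    star k V (decorate k T w) (decorate k S u) = ∑ a, decorate k (T.graft a S) (Sum.elim w u) := by
  rw [decorate, decorate, star_of]
  refine (Fintype.sum_equiv (Fintype.equivFin α) _ _ fun a => ?_).symm
  rw [RTree.graft_relabel, decorate_relabel]
  congr 1
  funext x
  rcases x with x | x <;> simp

theorem map_decorate (f : V →ₗ[k] W) (T : RTree α) (w : α → V) :
    map k f (decorate k T w) = decorate k T (f ∘ w) := by
  simp only [decorate, of, map, DirectSum.lmap_lof, Decorated.map, Decorated.of,
    Decorated.lift_mk, LinearMap.comp_apply, Finsupp.mapRange.linearMap_apply,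
    Finsupp.mapRange_single, PiTensorProduct.map_tprod]
  rfl

theorem decorate_unique [Unique α] (T : RTree α) (w : α → V) :
    decorate k T w = vertex k (w default) := by
  have relabel_T : T.relabel (Equiv.ofUnique α (Fin 1)) = RTree.single (Fin 1) :=
    RTree.ext_of_parent (Subsingleton.elim _ _)
  rw [decorate_eq_of (Equiv.ofUnique α (Fin 1)), relabel_T]
  rfl

theorem star_decorate_vertex (T : RTree α) (w : α → V) (v : V) :
    star k V (decorate k T w) (vertex k v) =
      ∑ a, decorate k (T.addLeaf a) (fun o => o.elim v w) := by
  rw [← decorate_unique (RTree.single (Fin 1)) fun _ => v, star_decorate]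
  refine Finset.sum_congr rfl fun a _ => ?_
  rw [RTree.addLeaf, decorate_relabel]
  congr 1
  funext x
  rcases x with x | x <;> rfl

theorem star_vertex_decorate (T : RTree α) (w : α → V) (v : V) :
    star k V (vertex k v) (decorate k T w) = decorate k T.addRoot (fun o => o.elim v w) := by
  rw [← decorate_unique (RTree.single (Fin 1)) fun _ => v, star_decorate, Fintype.sum_unique,
    RTree.addRoot, decorate_relabel]
  congr 1
  funext x
  rcases x with x | x <;> rfl

theorem star_star_sub_star_star_decorate (T : RTree α) (S : RTree β) (R : RTree γ) (w : α → V)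
    (u : β → V) (t : γ → V) :
    star k V (star k V (decorate k T w) (decorate k S u)) (decorate k R t) -
        star k V (decorate k T w) (star k V (decorate k S u) (decorate k R t)) =
      ∑ a, ∑ b, decorate k ((T.graft a S).graft (Sum.inl b) R) (Sum.elim (Sum.elim w u) t) := by
  simp only [star_decorate, map_sum, LinearMap.sum_apply, Fintype.sum_sum_type,
    Finset.sum_add_distrib]
  rw [Finset.sum_comm (s := (Finset.univ : Finset β)), add_sub_assoc, add_eq_left, sub_eq_zero]
  refine Finset.sum_congr rfl fun a _ => Finset.sum_congr rfl fun b _ => ?_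
  rw [← RTree.graft_graft_inr, decorate_relabel]
  congr 1
  funext x
  rcases x with (x | x) | x <;> rfl

/-- The associator is symmetric since grafting two trees onto vertices of a third one can be done
in either order. -/
theorem star_star_sub_star_star_comm (x y z : Tr k V) :
    star k V (star k V x y) z - star k V x (star k V y z) =
      star k V (star k V x z) y - star k V x (star k V z y) := by
  induction x using Tr.induction with
  | zero => simp
  | add x x' hx hx' => simp only [map_add, LinearMap.add_apply, add_sub_add_comm, hx, hx']
  | smul r x hx => simp only [map_smul, LinearMap.smul_apply, ← smul_sub, hx]
  | of m T w =>
  induction y using Tr.induction with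
  | zero => simp
  | add y y' hy hy' => simp only [map_add, LinearMap.add_apply, add_sub_add_comm, hy, hy']
  | smul r y hy => simp only [map_smul, LinearMap.smul_apply, ← smul_sub, hy]
  | of n S u =>
  induction z using Tr.induction with
  | zero => simp
  | add z z' hz hz' => simp only [map_add, LinearMap.add_apply, add_sub_add_comm, hz, hz']
  | smul r z hz => simp only [map_smul, LinearMap.smul_apply, ← smul_sub, hz]
  | of l R t =>
    rw [← decorate_fin, ← decorate_fin, ← decorate_fin, star_star_sub_star_star_decorate,
      star_star_sub_star_star_decorate, Finset.sum_comm]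
    refine Finset.sum_congr rfl fun a _ => Finset.sum_congr rfl fun b _ => ?_
    rw [← RTree.graft_graft_inl, decorate_relabel]
    congr 1
    funext x
    rcases x with (x | x) | x <;> rfl

variable (k V) in
/-- The Lie ring of decorated trees, with the commutator of the pre-Lie product as its bracket. -/
@[reducible] def lieRing : LieRing (Tr k V) where
  bracket x y := star k V x y - star k V y x
  add_lie x y z := by simp only [map_add, LinearMap.add_apply]; abel
  lie_add x y z := by simp only [map_add, LinearMap.add_apply]; abel
  lie_self x := sub_self _
  leibniz_lie x y z := by
    have comm_x := star_star_sub_star_star_comm x y z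
    have comm_y := star_star_sub_star_star_comm y x z
    have comm_z := star_star_sub_star_star_comm z x y
    simp only [map_sub, LinearMap.sub_apply]
    linear_combination (norm := module) comm_y - comm_x - comm_z

attribute [local instance] lieRing

theorem lie_def (x y : Tr k V) : ⁅x, y⁆ = star k V x y - star k V y x := rfl

variable (k V) in
/-- The Lie algebra of decorated trees, with the commutator of the pre-Lie product as its
bracket. -/
@[reducible] def lieAlgebra : LieAlgebra k (Tr k V) where
  lie_smul r x y := by simp only [lie_def, map_smul, LinearMap.smul_apply, smul_sub]

attribute [local instance] lieAlgebra

theorem map_star (f : V →ₗ[k] W) (x y : Tr k V) :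
    map k f (star k V x y) = star k W (map k f x) (map k f y) := by
  induction x using Tr.induction with
  | zero => simp
  | add x x' hx hx' => simp only [map_add, LinearMap.add_apply, hx, hx']
  | smul r x hx => simp only [map_smul, LinearMap.smul_apply, hx]
  | of m T w =>
  induction y using Tr.induction with
  | zero => simp
  | add y y' hy hy' => simp only [map_add, hy, hy']
  | smul r y hy => simp only [map_smul, hy]
  | of n S u => simp only [← decorate_fin, star_decorate, map_decorate, map_sum, Sum.comp_elim]

variable (k) in
/-- The functoriality of decorated trees, as a homomorphism of Lie algebras. -/
def mapLie (f : V →ₗ[k] W) : Tr k V →ₗ⁅k⁆ Tr k W where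
  toLinearMap := map k f
  map_lie' {x y} := by
    change map k f ⁅x, y⁆ = ⁅map k f x, map k f y⁆
    rw [lie_def, lie_def, map_sub, map_star, map_star]

variable (k V) in
/-- The embedding of the decorations as one-vertex trees. -/
def vertexHom : V →ₗ[k] Tr k V :=
  mk k V 1 ∘ₗ Finsupp.lsingle (RTree.single (Fin 1)) ∘ₗ
    (MultilinearMap.ofSubsingleton k V _ (0 : Fin 1)).symm (PiTensorProduct.tprod k)

end Tr

/-! ### Left-normed brackets in the free Lie algebra -/

namespace FreeLie

variable {k : Type*} [CommRing k] {V : Type*} [AddCommGroup V] [Module k V]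

theorem induction {p : FreeLie k V → Prop} (zero : p 0) (add : ∀ x y, p x → p y → p (x + y))
    (smul : ∀ (r : k) x, p x → p (r • x)) (lie : ∀ x y, p x → p y → p ⁅x, y⁆)
    (of : ∀ v, p (of k v)) (x : FreeLie k V) : p x := by
  let K : LieSubalgebra k (FreeLie k V) :=
    { carrier := {x | p x}
      zero_mem' := zero
      add_mem' := fun {x y} hx hy => add x y hx hy
      smul_mem' := fun r x hx => smul r x hx
      lie_mem' := fun {x y} hx hy => lie x y hx hy }
  let f : V →ₗ[k] K := LinearMap.codRestrict K.toSubmodule (FreeLie.of k) of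
  have incl_comp_lift : K.incl.comp (lift k f) = LieHom.id := by
    refine hom_ext k fun v => ?_
    rw [LieHom.comp_apply, lift_of]
    rfl
  have lift_eq : K.incl (lift k f x) = x := LieHom.congr_fun incl_comp_lift x
  exact lift_eq ▸ (lift k f x).2

theorem eq_top_of_lie_mem {A : Submodule k (FreeLie k V)} (of_mem : ∀ v, of k v ∈ A)
    (lie_of_mem : ∀ a ∈ A, ∀ v, ⁅a, of k v⁆ ∈ A) : A = ⊤ := by
  have lie_mem : ∀ y, ∀ a ∈ A, ⁅a, y⁆ ∈ A := fun y => by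
    induction y using FreeLie.induction with
    | zero => intro a _; simp
    | add x y hx hy =>
      intro a ha
      rw [lie_add]
      exact A.add_mem (hx a ha) (hy a ha)
    | smul r x hx =>
      intro a ha
      rw [lie_smul]
      exact A.smul_mem r (hx a ha)
    | lie x y hx hy =>
      intro a ha
      rw [leibniz_lie, ← lie_skew x ⁅a, y⁆, ← sub_eq_add_neg]
      exact A.sub_mem (hy _ (hx a ha)) (hx _ (hy a ha))
    | of v => exact fun a ha => lie_of_mem a ha v
  refine Submodule.eq_top_iff'.2 fun x => ?_
  induction x using FreeLie.induction with
  | zero => exact A.zero_mem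
  | add x y hx hy => exact A.add_mem hx hy
  | smul r x hx => exact A.smul_mem r hx
  | lie x y hx _ => exact lie_mem y x hx
  | of v => exact of_mem v

variable (k V) in
/-- The bracket `⁅x, v⁆` of an element of the free Lie algebra with an element of `V`, as a bilinear
map. -/
def lieOf : FreeLie k V →ₗ[k] V →ₗ[k] FreeLie k V :=
  LinearMap.mk₂ k (fun x v => ⁅x, of k v⁆)
    (fun x y v => add_lie x y _) (fun r x v => smul_lie r x _)
    (fun x v w => by rw [map_add, lie_add]) fun r x v => by rw [map_smul, lie_smul]

variable (k V) in
/-- The left-normed bracket `[…[[v₀, v₁], v₂], …, vₙ₋₁]` in the free Lie algebra, which is taken to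
be zero for the empty sequence. -/
def leftBracket : (n : ℕ) → MultilinearMap k (fun _ : Fin n => V) (FreeLie k V)
  | 0 => 0
  | 1 => MultilinearMap.ofSubsingleton k V _ (0 : Fin 1) (of k)
  | n + 2 => ((lieOf k V).compMultilinearMap (leftBracket (n + 1))).uncurryRight

theorem leftBracket_one (w : Fin 1 → V) : leftBracket k V 1 w = of k (w 0) := rfl

theorem leftBracket_add_two {n : ℕ} (w : Fin (n + 2) → V) :
    leftBracket k V (n + 2) w =
      ⁅leftBracket k V (n + 1) (Fin.init w), of k (w (Fin.last (n + 1)))⁆ := by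
  rw [leftBracket]
  rfl

theorem span_leftBracket :
    Submodule.span k (⋃ n, Set.range (leftBracket k V n)) = ⊤ := by
  refine eq_top_of_lie_mem (fun v => Submodule.subset_span ?_) fun a ha v => ?_
  · exact Set.mem_iUnion.2 ⟨1, fun _ => v, rfl⟩
  · induction ha using Submodule.span_induction with
    | zero => simp
    | add a b _ _ ha hb => rw [add_lie]; exact Submodule.add_mem _ ha hb
    | smul r a _ ha => rw [smul_lie]; exact Submodule.smul_mem _ r ha
    | mem a ha =>
      obtain ⟨_ | n, w, rfl⟩ := Set.mem_iUnion.1 ha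
      · simp [leftBracket]
      · refine Submodule.subset_span (Set.mem_iUnion.2 ⟨n + 2, Fin.snoc w v, ?_⟩)
        rw [leftBracket_add_two, Fin.init_snoc, Fin.snoc_last]

end FreeLie

/-! ### The expansion of left-normed brackets into trees -/

section BracketSum

variable {k : Type*} [CommRing k] {V W : Type*} [AddCommGroup V] [Module k V]
  [AddCommGroup W] [Module k W]

attribute [local instance] Tr.lieRing Tr.lieAlgebra

variable (k) in
/-- The homomorphism from the free Lie algebra to the Lie algebra of decorated trees which sends the
elements of `V` to one-vertex trees. -/
def toTrees : FreeLie k V →ₗ⁅k⁆ Tr k V := FreeLie.lift k (Tr.vertexHom k V)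

@[simp] theorem toTrees_of (x : V) : toTrees k (FreeLie.of k x) = Tr.vertex k x :=
  FreeLie.lift_of k (Tr.vertexHom k V) x

theorem toTrees_lie (x y : FreeLie k V) : toTrees k ⁅x, y⁆ =
    star k V (toTrees k x) (toTrees k y) - star k V (toTrees k y) (toTrees k x) :=
  LieHom.map_lie (toTrees k) x y

theorem toTrees_map (f : V →ₗ[k] W) (x : FreeLie k V) :
    toTrees k (FreeLie.map k f x) = Tr.map k f (toTrees k x) := by
  have map_vertex : ∀ v, Tr.map k f (Tr.vertex k v) = Tr.vertex k (f v) := fun v => by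
    rw [Tr.vertex, ← Tr.decorate_fin, Tr.map_decorate, Tr.decorate_unique, Function.comp_apply]
  have comp_map : (toTrees k).comp (FreeLie.map k f) = (Tr.mapLie k f).comp (toTrees k) := by
    refine FreeLie.hom_ext k fun v => ?_
    change toTrees k (FreeLie.map k f (FreeLie.of k v)) = Tr.map k f (toTrees k (FreeLie.of k v))
    rw [FreeLie.map, FreeLie.lift_of, LinearMap.comp_apply, toTrees_of, toTrees_of, map_vertex]
  exact LieHom.congr_fun comp_map x

variable {α β : Type*} [Fintype α] [Fintype β]

variable (k) in
/-- The expansion into trees of the left-normed bracket of the decorations `w a`, listed by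
increasing rank `ρ a`. -/
def bracketSum (ρ : α → ℕ) (w : α → V) : Tr k V :=
  ∑ T : RTree α, RTree.bracketCoeff ρ T • Tr.decorate k T w

theorem bracketSum_comp (e : α ≃ β) (ρ : β → ℕ) (w : β → V) :
    bracketSum k (ρ ∘ e) (w ∘ e) = bracketSum k ρ w := by
  refine Fintype.sum_equiv (RTree.relabelEquiv e) _ _ fun T => ?_
  change _ = RTree.bracketCoeff ρ (T.relabel e) • Tr.decorate k (T.relabel e) w
  rw [RTree.bracketCoeff_relabel, Tr.decorate_relabel]

theorem bracketSum_of_isEmpty [IsEmpty α] (ρ : α → ℕ) (w : α → V) : bracketSum k ρ w = 0 :=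
  Finset.sum_eq_zero fun T _ => isEmptyElim T.root

theorem bracketSum_unique [Unique α] (ρ : α → ℕ) (w : α → V) :
    bracketSum k ρ w = Tr.vertex k (w default) := by
  have eq_single : ∀ T : RTree α, T = RTree.single α := fun T =>
    RTree.ext_of_parent (Subsingleton.elim _ _)
  have bracketCoeff_eq_one : RTree.bracketCoeff ρ (RTree.single α) = 1 := by
    rw [RTree.bracketCoeff_of_isIncreasing fun i j l _ _ _ _ => Subsingleton.elim j l]
    exact Finset.prod_eq_one fun i _ => if_neg (lt_irrefl _)
  rw [bracketSum, Fintype.sum_eq_single _ fun T hT => absurd (eq_single T) hT, Tr.decorate_unique,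
    bracketCoeff_eq_one, one_smul]

theorem lie_bracketSum_vertex [Nonempty α] {ρ : Option α → ℕ} (hρ : ∀ x, ρ (some x) < ρ none)
    (w : α → V) (v : V) :
    ⁅bracketSum k (ρ ∘ some) w, Tr.vertex k v⁆ = bracketSum k ρ fun o => o.elim v w := by
  rw [bracketSum, bracketSum, RTree.sum_bracketCoeff_smul_option hρ, sum_lie]
  refine Finset.sum_congr rfl fun T _ => ?_
  rw [smul_lie, Tr.lie_def, Tr.star_decorate_vertex, Tr.star_vertex_decorate]

theorem lie_bracketSum_val {n : ℕ} (w : Fin (n + 2) → V) :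
    ⁅bracketSum k Fin.val (Fin.init w), Tr.vertex k (w (Fin.last (n + 1)))⁆ =
      bracketSum k Fin.val w := by
  let e : Option (Fin (n + 1)) ≃ Fin (n + 2) := finSuccEquivLast.symm
  have val_e : (Fin.val ∘ e) ∘ some = Fin.val := funext fun i => by simp [e]
  have w_e : w ∘ e = fun o => o.elim (w (Fin.last (n + 1))) (Fin.init w) := by
    funext o
    rcases o with _ | i <;> simp [e, Fin.init]
  have val_e_lt : ∀ i, (Fin.val ∘ e) (some i) < (Fin.val ∘ e) none := fun i => by
    simpa [e] using Nat.lt_succ_iff.1 i.2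
  rw [← bracketSum_comp e, w_e, ← val_e, lie_bracketSum_vertex val_e_lt]

theorem toTrees_leftBracket {n : ℕ} (w : Fin n → V) :
    toTrees k (FreeLie.leftBracket k V n w) = bracketSum k Fin.val w := by
  rcases n with _ | n
  · rw [bracketSum_of_isEmpty]
    exact map_zero _
  induction n with
  | zero =>
    change _ = bracketSum k (α := Fin 1) Fin.val w
    rw [FreeLie.leftBracket_one, toTrees_of, bracketSum_unique]
    rfl
  | succ n ih =>
    rw [FreeLie.leftBracket_add_two, LieHom.map_lie, ih, toTrees_of, lie_bracketSum_val]

theorem RTree.IsLadder.exists_equiv_depth {T : RTree α} (hT : T.IsLadder) {n : ℕ}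
    (hn : Fintype.card α = n) : ∃ e : α ≃ Fin n, Fin.val ∘ e = T.depth := by
  have depth_lt : ∀ a, T.depth a < n := fun a => by
    choose b hb using fun j : Fin (T.depth a + 1) => T.exists_depth_eq a (Nat.lt_succ_iff.1 j.2)
    have b_injective : Function.Injective b := fun i j h =>
      Fin.ext ((hb i).symm.trans ((congrArg T.depth h).trans (hb j)))
    simpa [hn] using Fintype.card_le_of_injective b b_injective
  refine ⟨Equiv.ofBijective (fun a => ⟨T.depth a, depth_lt a⟩) ?_, rfl⟩
  refine (Fintype.bijective_iff_injective_and_card _).2 ⟨fun a b h => ?_, by simpa using hn⟩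
  exact hT.depth_injective (Fin.mk.inj_iff.1 h)

theorem bracketSum_depth_mem_range {T : RTree α} (hT : T.IsLadder) (w : α → V) :
    bracketSum k T.depth w ∈ LinearMap.range (toTrees k (V := V)).toLinearMap := by
  obtain ⟨e, he⟩ := hT.exists_equiv_depth rfl
  refine ⟨FreeLie.leftBracket k V _ (w ∘ e.symm), ?_⟩
  rw [LieHom.coe_toLinearMap, toTrees_leftBracket, ← bracketSum_comp e, he, Function.comp_assoc,
    Equiv.symm_comp_self, Function.comp_id]

end BracketSum

/-! ### The kernel of `δ` -/

section Delta

variable {k : Type*} [CommRing k] {V : Type*} [AddCommGroup V] [Module k V] {n : ℕ}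

theorem zsmul_single_apply {X M : Type*} [AddCommGroup M] [DecidableEq X] (c : ℤ) (x y : X)
    (t : M) : (c • Finsupp.single x t) y = if x = y then c • t else 0 := by
  rw [← Finsupp.single_apply, ← Finsupp.singleAddHom_apply, ← Finsupp.singleAddHom_apply, map_zsmul]

open Classical in
theorem deltaTensor_apply (f : SpanTensor k V n (RTree (Fin n))) (S : RTree (Option (Fin n))) :
    deltaTensor k V n f S =
      ∑ x, ∑ T : RTree (Fin n), if (S, x) ∈ T.blowUps then RTree.sign (S, x) • f T else 0 := by
  conv_lhs => rw [← Finsupp.univ_sum_single f]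
  rw [map_sum, Finsupp.finsetSum_apply, Finset.sum_comm]
  refine Finset.sum_congr rfl fun T _ => ?_
  rw [deltaTensor_single, Finsupp.finsetSum_apply, Finset.sum_filter, Fintype.sum_prod_type,
    Fintype.sum_eq_single S]
  · refine Finset.sum_congr rfl fun x _ => ?_
    rw [zsmul_single_apply, if_pos rfl]
  · intro S' hS'
    refine Finset.sum_eq_zero fun x _ => ?_
    rw [zsmul_single_apply, if_neg hS', ite_self]

theorem deltaTensor_apply_of_lt (f : SpanTensor k V n (RTree (Fin n)))
    {S : RTree (Option (Fin n))} (hS : S.arity none < 2) : deltaTensor k V n f S = 0 := by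
  rw [deltaTensor_apply]
  exact Finset.sum_eq_zero fun x _ => Finset.sum_eq_zero fun T _ =>
    if_neg fun h => hS.not_ge h.2.2

open Classical in
theorem deltaTensor_apply_of_le (f : SpanTensor k V n (RTree (Fin n)))
    {S : RTree (Option (Fin n))} (hS : 2 ≤ S.arity none) :
    deltaTensor k V n f S =
      ∑ x : {x // RTree.IsSpecialEdge S x}, RTree.sign (S, x.1) • f (S.contract x.2) := by
  have mem_blowUps {x : Fin n} (hx : RTree.IsSpecialEdge S x) (T : RTree (Fin n)) :
      (S, x) ∈ T.blowUps ↔ T = S.contract hx :=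
    ⟨fun h => (RTree.isContraction_iff hx T).1 h.2.1,
      fun h => ⟨hx, (RTree.isContraction_iff hx T).2 h, hS⟩⟩
  have special_of_ne_zero : ∀ x ∈ Finset.univ, (∑ T : RTree (Fin n),
      if (S, x) ∈ T.blowUps then RTree.sign (S, x) • f T else 0) ≠ 0 → RTree.IsSpecialEdge S x := by
    intro x _ hx
    by_contra hspecial
    exact hx (Finset.sum_eq_zero fun T _ => if_neg fun h => hspecial h.1)
  rw [deltaTensor_apply, ← Finset.sum_filter_of_ne special_of_ne_zero,
    Finset.sum_subtype _ fun x => Finset.mem_filter_univ x]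
  refine Finset.sum_congr rfl fun x _ => ?_
  rw [Fintype.sum_eq_single (S.contract x.2) fun T hT => if_neg (hT ∘ (mem_blowUps x.2 T).1),
    if_pos ((mem_blowUps x.2 _).2 rfl)]

theorem deltaTensor_eq_zero_iff (f : SpanTensor k V n (RTree (Fin n))) :
    deltaTensor k V n f = 0 ↔ RTree.IsBalanced f := by
  classical
  refine ⟨fun h S hS => ?_, fun h => Finsupp.ext fun S => ?_⟩
  · simpa only [h, Finsupp.coe_zero, Pi.zero_apply, eq_comm] using deltaTensor_apply_of_le f hS
  · rcases lt_or_ge (S.arity none) 2 with hS | hS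
    · exact deltaTensor_apply_of_lt f hS
    · exact (deltaTensor_apply_of_le f hS).trans (h S hS)

theorem delta_mk (f : SpanTensor k V n (RTree (Fin n))) :
    delta k V (Tr.mk k V n f) =
      DirectSum.lof k ℕ (fun n => Decorated k V n (RTree (Option (Fin n)))) n
        (Decorated.mk k V n _ (deltaTensor k V n f)) := by
  rw [Tr.mk, LinearMap.comp_apply, delta, DirectSum.lmap_lof, Decorated.lift_mk,
    LinearMap.comp_apply]

/-! ### Tensors with integral coefficients on trees -/

variable (k V) in
/-- For an integer valued function `c` on trees, the linear map which sends a tensor `t` to the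
element `T ↦ c T • t` of `Span(Trₙ) ⊗ V^{⊗ n}`. -/
def smulTensor (c : RTree (Fin n) → ℤ) :
    (⨂[k] _ : Fin n, V) →ₗ[k] SpanTensor k V n (RTree (Fin n)) :=
  ∑ T, c T • Finsupp.lsingle T

theorem smulTensor_eq_sum (c : RTree (Fin n) → ℤ) (t : ⨂[k] _ : Fin n, V) :
    smulTensor k V c t = ∑ T, c T • Finsupp.single T t := by
  rw [smulTensor, LinearMap.sum_apply]
  rfl

theorem smulTensor_apply (c : RTree (Fin n) → ℤ) (t : ⨂[k] _ : Fin n, V) (T : RTree (Fin n)) :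
    smulTensor k V c t T = c T • t := by
  classical
  rw [smulTensor_eq_sum, Finsupp.finsetSum_apply, Fintype.sum_eq_single T]
  · rw [zsmul_single_apply, if_pos rfl]
  · intro T' hT'
    rw [zsmul_single_apply, if_neg hT']

theorem mk_smulTensor_bracketCoeff (ρ : Fin n → ℕ) (w : Fin n → V) :
    Tr.mk k V n (smulTensor k V (RTree.bracketCoeff ρ) (PiTensorProduct.tprod k w)) =
      bracketSum k ρ w := by
  rw [smulTensor_eq_sum, map_sum, bracketSum]
  refine Finset.sum_congr rfl fun T _ => ?_
  rw [map_zsmul, Tr.mk_single, Tr.decorate_fin]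

theorem deltaTensor_smulTensor_bracketCoeff {ρ : Fin n → ℕ} (hρ : Function.Injective ρ)
    (t : ⨂[k] _ : Fin n, V) : deltaTensor k V n (smulTensor k V (RTree.bracketCoeff ρ) t) = 0 := by
  have coe_smulTensor : ⇑(smulTensor k V (RTree.bracketCoeff ρ) t) =
      fun T => RTree.bracketCoeff ρ T • t := funext fun T => smulTensor_apply _ t T
  rw [deltaTensor_eq_zero_iff, coe_smulTensor]
  exact RTree.isBalanced_bracketCoeff hρ t

open Classical in
theorem eq_sum_smulTensor_of_deltaTensor_eq_zero {f : SpanTensor k V n (RTree (Fin n))}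
    (hf : deltaTensor k V n f = 0) (z : Fin n) :
    f = ∑ T : RTree (Fin n) with T.root = z ∧ T.IsLadder,
      smulTensor k V (RTree.bracketCoeff T.depth) (f T) := by
  set g := ∑ T : RTree (Fin n) with T.root = z ∧ T.IsLadder,
    smulTensor k V (RTree.bracketCoeff T.depth) (f T) with hg
  have sub_balanced : RTree.IsBalanced ⇑(f - g) := by
    rw [← deltaTensor_eq_zero_iff, map_sub, hf, hg, map_sum, zero_sub, neg_eq_zero]
    refine Finset.sum_eq_zero fun T hT => deltaTensor_smulTensor_bracketCoeff ?_ _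
    exact ((Finset.mem_filter_univ _).1 hT).2.depth_injective
  rw [← sub_eq_zero]
  refine Finsupp.ext (sub_balanced.eq_zero_of_isLadder z fun L hz hL => ?_)
  rw [Finsupp.sub_apply, hg, Finsupp.finsetSum_apply, Finset.sum_eq_single L, smulTensor_apply,
    RTree.bracketCoeff_depth_self, one_smul, sub_self]
  · intro T hT hne
    obtain ⟨hTz, hT⟩ := (Finset.mem_filter_univ _).1 hT
    rw [smulTensor_apply, RTree.bracketCoeff_depth_of_ne hT hL (hz.trans hTz.symm) hne.symm,
      zero_smul]
  · exact fun h => absurd ((Finset.mem_filter_univ _).2 ⟨hz, hL⟩) h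

attribute [local instance] Tr.lieRing Tr.lieAlgebra

theorem delta_toTrees (x : FreeLie k V) : delta k V (toTrees k x) = 0 := by
  suffices h : ⊤ ≤ LinearMap.ker (delta k V ∘ₗ (toTrees k (V := V)).toLinearMap) from
    h (Submodule.mem_top (x := x))
  rw [← FreeLie.span_leftBracket, Submodule.span_le, Set.iUnion_subset_iff]
  rintro n _ ⟨w, rfl⟩
  change delta k V (toTrees k (FreeLie.leftBracket k V n w)) = 0
  rw [toTrees_leftBracket, ← mk_smulTensor_bracketCoeff, delta_mk,
    deltaTensor_smulTensor_bracketCoeff Fin.val_injective, map_zero, map_zero]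

theorem mk_smulTensor_depth_mem_range {T : RTree (Fin n)} (hT : T.IsLadder)
    (t : ⨂[k] _ : Fin n, V) :
    Tr.mk k V n (smulTensor k V (RTree.bracketCoeff T.depth) t) ∈
      LinearMap.range (toTrees k (V := V)).toLinearMap := by
  induction t using PiTensorProduct.induction_on with
  | add a b ha hb =>
    rw [map_add, map_add]
    exact Submodule.add_mem _ ha hb
  | smul_tprod r w =>
    rw [map_smul, map_smul, mk_smulTensor_bracketCoeff]
    exact Submodule.smul_mem _ r (bracketSum_depth_mem_range hT w)

theorem mk_mem_range_of_deltaTensor_eq_zero {f : SpanTensor k V n (RTree (Fin n))}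
    (hf : deltaTensor k V n f = 0) :
    Tr.mk k V n f ∈ LinearMap.range (toTrees k (V := V)).toLinearMap := by
  classical
  rcases isEmpty_or_nonempty (Fin n) with hn | ⟨⟨z⟩⟩
  · rw [show f = 0 from Finsupp.ext fun T => isEmptyElim T.root, map_zero]
    exact Submodule.zero_mem _
  · rw [eq_sum_smulTensor_of_deltaTensor_eq_zero hf z, map_sum]
    refine Submodule.sum_mem _ fun T hT => mk_smulTensor_depth_mem_range ?_ _
    exact ((Finset.mem_filter_univ _).1 hT).2

end Delta

/-! ### Symmetrization -/

section Symmetrize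

variable {k : Type*} [CommRing k] {V : Type*} [AddCommGroup V] [Module k V] {n : ℕ}

section

variable {X : Type*} [MulAction (Equiv.Perm (Fin n)) X]

theorem diag_mul (σ τ : Equiv.Perm (Fin n)) (z : SpanTensor k V n X) :
    diag k V n X (σ * τ) z = diag k V n X σ (diag k V n X τ z) := by
  induction z using Finsupp.induction_linear with
  | zero => rw [map_zero, map_zero, map_zero]
  | add a b ha hb => rw [map_add, map_add, map_add, ha, hb]
  | single x t => rw [diag_single, diag_single, diag_single, mul_smul, map_mul]; rfl

variable (k V n X) in
/-- The map from coinvariants to invariants which sends the class of `z` to the sum of the orbit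
`∑ σ, σ z`, without dividing by `n!`. -/
def symmetrize : Decorated k V n X →ₗ[k] SpanTensor k V n X :=
  Decorated.lift (∑ σ, diag k V n X σ) fun τ z => by
    rw [LinearMap.sum_apply, LinearMap.sum_apply]
    exact Fintype.sum_equiv (Equiv.mulRight τ) _ _ fun σ => (diag_mul σ τ z).symm

theorem symmetrize_mk (z : SpanTensor k V n X) :
    symmetrize k V n X (Decorated.mk k V n X z) = ∑ σ, diag k V n X σ z := by
  rw [symmetrize, Decorated.lift_mk, LinearMap.sum_apply]

end

theorem Tr.mk_sum_diag (z : SpanTensor k V n (RTree (Fin n))) :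
    Tr.mk k V n (∑ σ, diag k V n _ σ z) = (n.factorial : k) • Tr.mk k V n z := by
  rw [map_sum, Finset.sum_congr rfl fun σ _ => Tr.mk_diag σ z, Finset.sum_const, Finset.card_univ,
    Fintype.card_perm, Fintype.card_fin, Nat.cast_smul_eq_nsmul]

theorem deltaTensor_sum_diag {z : SpanTensor k V n (RTree (Fin n))}
    (hz : delta k V (Tr.mk k V n z) = 0) : deltaTensor k V n (∑ σ, diag k V n _ σ z) = 0 := by
  have mk_deltaTensor : Decorated.mk k V n _ (deltaTensor k V n z) = 0 :=
    DirectSum.of_injective n ((delta_mk z).symm.trans (hz.trans (map_zero _).symm))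
  rw [map_sum, Finset.sum_congr rfl fun σ _ => deltaTensor_diag k V σ z, ← symmetrize_mk,
    mk_deltaTensor, map_zero]

end Symmetrize

section Surjectivity

variable {k : Type*} [CommRing k] [Algebra ℚ k] {V : Type*} [AddCommGroup V] [Module k V]

theorem isUnit_natCast_of_ne_zero {n : ℕ} (hn : n ≠ 0) : IsUnit (n : k) := by
  simpa using (Nat.cast_ne_zero.2 hn : (n : ℚ) ≠ 0).isUnit.map (algebraMap ℚ k)

attribute [local instance] Tr.lieRing Tr.lieAlgebra

theorem mk_mem_range_of_delta_eq_zero {n : ℕ} {z : SpanTensor k V n (RTree (Fin n))}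
    (hz : delta k V (Tr.mk k V n z) = 0) :
    Tr.mk k V n z ∈ LinearMap.range (toTrees k (V := V)).toLinearMap := by
  rw [← Submodule.smul_mem_iff_of_isUnit _ (isUnit_natCast_of_ne_zero n.factorial_ne_zero),
    ← Tr.mk_sum_diag]
  exact mk_mem_range_of_deltaTensor_eq_zero (deltaTensor_sum_diag hz)

theorem mem_range_of_delta_eq_zero {x : Tr k V} (hx : delta k V x = 0) :
    x ∈ LinearMap.range (toTrees k (V := V)).toLinearMap := by
  classical
  rw [← DirectSum.sum_support_of x]
  refine Submodule.sum_mem _ fun n _ => ?_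
  obtain ⟨z, hz⟩ := Decorated.mk_surjective k V n _ (x n)
  have of_component : DirectSum.of _ n (x n) = Tr.mk k V n z :=
    (congrArg (DirectSum.lof k ℕ (fun n => Decorated k V n (RTree (Fin n))) n) hz).symm
  rw [of_component]
  refine mk_mem_range_of_delta_eq_zero ?_
  have delta_component := DFunLike.congr_fun hx n
  rw [delta, DirectSum.lmap_apply, ← hz, Decorated.lift_mk, LinearMap.comp_apply] at delta_component
  rw [delta_mk, delta_component]
  exact map_zero _

end Surjectivity

/-! ### Standard ladders -/

section ExtendLast

variable {α : Type*} {n : ℕ}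

/-- The extension of a numbering of `α` to `Option α` which gives the last number to `none`. -/
def extendLast (e : α ≃ Fin n) : Option α ≃ Fin (n + 1) :=
  (Equiv.optionCongr e).trans finSuccEquivLast.symm

@[simp] theorem extendLast_some (e : α ≃ Fin n) (x : α) :
    extendLast e (some x) = (e x).castSucc := by
  simp [extendLast]

@[simp] theorem extendLast_none (e : α ≃ Fin n) : extendLast e none = Fin.last n := by
  simp [extendLast]

@[simp] theorem extendLast_symm_castSucc (e : α ≃ Fin n) (i : Fin n) :
    (extendLast e).symm i.castSucc = some (e.symm i) := by
  rw [Equiv.symm_apply_eq, extendLast_some, e.apply_symm_apply]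

@[simp] theorem extendLast_symm_last (e : α ≃ Fin n) :
    (extendLast e).symm (Fin.last n) = none := by
  rw [Equiv.symm_apply_eq, extendLast_none]

theorem extendLast_injective : Function.Injective (extendLast : (α ≃ Fin n) → _) :=
  fun e e' h => Equiv.ext fun x => Fin.castSucc_injective _ <| by
    simpa using DFunLike.congr_fun h (some x)

theorem exists_extendLast_eq {e : Option α ≃ Fin (n + 1)} (he : e none = Fin.last n) :
    ∃ e', extendLast e' = e := by
  let f : Option α ≃ Option (Fin n) := e.trans finSuccEquivLast
  have f_none : f none = none := by simp [f, he]
  refine ⟨f.removeNone, Equiv.ext fun o => finSuccEquivLast.injective ?_⟩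
  rcases o with _ | x
  · rw [extendLast_none, he]
  · have f_some : ∃ y, f (some x) = some y := Option.ne_none_iff_exists'.1 fun h =>
      Option.some_ne_none x (f.injective (h.trans f_none.symm))
    rw [extendLast_some, finSuccEquivLast_castSucc, Equiv.removeNone_some f f_some]
    rfl

end ExtendLast

namespace RTree

variable {α : Type*}

/-- The ladder whose root is the first vertex and in which the parent of every other vertex is the
preceding one. The equation also covers the root: it is its own parent, and `0 - 1 = 0`. -/
def IsStandardLadder {n : ℕ} (T : RTree (Fin n)) : Prop :=
  ∀ i, (T.parent i : ℕ) = (i : ℕ) - 1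

theorem isStandardLadder_relabel {n : ℕ} {T : RTree α} {e : α ≃ Fin n} :
    (T.relabel e).IsStandardLadder ↔ ∀ x, (e (T.parent x) : ℕ) = (e x : ℕ) - 1 := by
  rw [IsStandardLadder, e.symm.forall_congr_left]
  simp only [relabel_parent, Equiv.symm_symm, e.symm_apply_apply]

theorem isStandardLadder_addLeaf {m : ℕ} (T : RTree α) (e : α ≃ Fin (m + 1)) :
    ((T.addLeaf (e.symm (Fin.last m))).relabel (extendLast e)).IsStandardLadder ↔
      (T.relabel e).IsStandardLadder := by
  rw [isStandardLadder_relabel, isStandardLadder_relabel]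
  constructor
  · intro h x
    simpa using h (some x)
  · rintro h (_ | x)
    · simp
    · simpa using h x

theorem exists_extendLast_of_isStandardLadder_addLeaf {m : ℕ} {T : RTree α} {a : α}
    {e : Option α ≃ Fin (m + 2)} (h : ((T.addLeaf a).relabel e).IsStandardLadder) :
    ∃ e' : α ≃ Fin (m + 1), e'.symm (Fin.last m) = a ∧ extendLast e' = e := by
  rw [isStandardLadder_relabel] at h
  have e_none : e none = Fin.last (m + 1) := by
    -- otherwise the vertex numbered next to the leaf `none` would be a child of it
    by_contra hne
    have e_none_lt : (e none : ℕ) < m + 1 := Fin.val_lt_last hne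
    obtain ⟨o, ho⟩ := e.surjective ⟨e none + 1, by omega⟩
    have parent_o : (T.addLeaf a).parent o = none :=
      e.injective (Fin.ext (by simpa [ho] using h o))
    cases o <;> simp at parent_o
  obtain ⟨e', rfl⟩ := exists_extendLast_eq e_none
  refine ⟨e', e'.symm_apply_eq.2 (Fin.ext ?_), rfl⟩
  simpa using (h none).symm

end RTree

/-! ### Reading off brackets from ladders -/

section OfTrees

variable (k : Type*) [CommRing k] (V : Type*) [AddCommGroup V] [Module k V]

open Classical in
/-- The map which sends a decorated ladder to the left-normed bracket of its decorations, listed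
from the root upwards, and all other decorated trees to zero. -/
def ofTrees : Tr k V →ₗ[k] FreeLie k V :=
  DirectSum.toModule k ℕ _ fun n => PiTensorProduct.lift (FreeLie.leftBracket k V n) ∘ₗ
    (∑ T : RTree (Fin n) with T.IsStandardLadder, Finsupp.lapply T) ∘ₗ
      symmetrize k V n (RTree (Fin n))

variable {k V}

open Classical in
theorem ofTrees_of {n : ℕ} (T : RTree (Fin n)) (w : Fin n → V) :
    ofTrees k V (Tr.of k T w) = ∑ e : Fin n ≃ Fin n,
      if (T.relabel e).IsStandardLadder then FreeLie.leftBracket k V n (w ∘ e.symm) else 0 := by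
  rw [ofTrees, Tr.of, DirectSum.toModule_lof, LinearMap.comp_apply, LinearMap.comp_apply,
    Decorated.of, symmetrize_mk, map_sum, map_sum]
  refine Finset.sum_congr rfl fun e _ => ?_
  rw [diag_single, permTensor_tprod, LinearMap.sum_apply, RTree.smul_def]
  simp only [Finsupp.lapply_apply, Finsupp.single_apply, Finset.sum_ite_eq, Finset.mem_filter_univ]
  split_ifs
  · exact PiTensorProduct.lift.tprod _
  · exact map_zero _

open Classical in
theorem ofTrees_decorate {α : Type*} [Fintype α] [DecidableEq α] {n : ℕ} (hn : Fintype.card α = n)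
    (T : RTree α) (w : α → V) : ofTrees k V (Tr.decorate k T w) = ∑ e : α ≃ Fin n,
      if (T.relabel e).IsStandardLadder then FreeLie.leftBracket k V n (w ∘ e.symm) else 0 := by
  have e₀ : α ≃ Fin n := Fintype.equivFinOfCardEq hn
  rw [Tr.decorate_eq_of e₀, ofTrees_of]
  refine Fintype.sum_equiv (Equiv.equivCongr e₀.symm (Equiv.refl _)) _ _ fun e => ?_
  rw [RTree.relabel_relabel]
  rfl

theorem ofTrees_vertex (v : V) : ofTrees k V (Tr.vertex k v) = FreeLie.of k v := by
  classical
  have isStandardLadder_single (e : Fin 1 ≃ Fin 1) :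
      ((RTree.single (Fin 1)).relabel e).IsStandardLadder := fun i => by
    rw [Fin.val_eq_zero, Fin.val_eq_zero]
  rw [Tr.vertex, ofTrees_of, Fintype.sum_unique, if_pos (isStandardLadder_single _)]
  rfl

open Classical in
theorem sum_ofTrees_addLeaf {α : Type*} [Fintype α] [DecidableEq α] {m : ℕ}
    (hm : Fintype.card α = m + 1) (T : RTree α) (w : α → V) (v : V) :
    ∑ a, ofTrees k V (Tr.decorate k (T.addLeaf a) fun o => o.elim v w) =
      ∑ e : α ≃ Fin (m + 1), if (T.relabel e).IsStandardLadder then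
        ⁅FreeLie.leftBracket k V (m + 1) (w ∘ e.symm), FreeLie.of k v⁆ else 0 := by
  have card_option : Fintype.card (Option α) = m + 2 := by rw [Fintype.card_option, hm]
  simp only [ofTrees_decorate card_option]
  rw [← Fintype.sum_prod_type']
  symm
  refine Finset.sum_of_injOn (fun e => (e.symm (Fin.last m), extendLast e))
    (fun e _ e' _ h => extendLast_injective (Prod.mk.inj h).2) (fun _ _ => Finset.mem_univ _) ?_ ?_
  · rintro ⟨a, e⟩ _ hae
    refine if_neg fun h => hae ?_
    obtain ⟨e', ha, he⟩ := RTree.exists_extendLast_of_isStandardLadder_addLeaf h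
    exact ⟨e', Finset.mem_coe.2 (Finset.mem_univ _), Prod.ext ha he⟩
  · intro e _
    have init_comp :
        Fin.init ((fun o : Option α => o.elim v w) ∘ (extendLast e).symm) = w ∘ e.symm :=
      funext fun i => by simp [Fin.init]
    simp only [RTree.isStandardLadder_addLeaf, FreeLie.leftBracket_add_two, init_comp,
      Function.comp_apply, extendLast_symm_last, Option.elim_none]

theorem ofTrees_star_vertex (x : Tr k V) (v : V) :
    ofTrees k V (star k V x (Tr.vertex k v)) = ⁅ofTrees k V x, FreeLie.of k v⁆ := by
  classical
  induction x using Tr.induction with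
  | zero => simp
  | add x y hx hy => simp only [map_add, LinearMap.add_apply, hx, hy, add_lie]
  | smul r x hx => simp only [map_smul, LinearMap.smul_apply, hx, smul_lie]
  | of n T w =>
    obtain ⟨m, rfl⟩ : ∃ m, n = m + 1 := Nat.exists_eq_add_one.2 T.root.pos
    rw [← Tr.decorate_fin, Tr.star_decorate_vertex, map_sum,
      sum_ofTrees_addLeaf (Fintype.card_fin _), ofTrees_decorate (Fintype.card_fin _), sum_lie]
    refine Finset.sum_congr rfl fun e _ => ?_
    split_ifs
    · rfl
    · exact (zero_lie _).symm

attribute [local instance] Tr.lieRing Tr.lieAlgebra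

theorem ofTrees_star_toTrees (x : Tr k V) (y : FreeLie k V) :
    ofTrees k V (star k V x (toTrees k y)) = ⁅ofTrees k V x, y⁆ := by
  induction y using FreeLie.induction generalizing x with
  | zero => simp
  | add y z hy hz => simp only [map_add, hy, hz, lie_add]
  | smul r y hy => simp only [map_smul, hy, lie_smul]
  | of v => rw [toTrees_of, ofTrees_star_vertex]
  | lie y z hy hz =>
    have star_lie : star k V x (toTrees k ⁅y, z⁆) =
        star k V (star k V x (toTrees k y)) (toTrees k z) -
          star k V (star k V x (toTrees k z)) (toTrees k y) := by
      rw [toTrees_lie, map_sub]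
      linear_combination (norm := module)
        Tr.star_star_sub_star_star_comm x (toTrees k z) (toTrees k y)
    rw [star_lie, map_sub, hz, hy, hy, hz, leibniz_lie, ← lie_skew y]
    abel

theorem ofTrees_toTrees_lie (x y : FreeLie k V) :
    ofTrees k V (toTrees k ⁅x, y⁆) =
      ⁅ofTrees k V (toTrees k x), y⁆ + ⁅x, ofTrees k V (toTrees k y)⁆ := by
  rw [toTrees_lie, map_sub, ofTrees_star_toTrees, ofTrees_star_toTrees, ← lie_skew x,
    sub_eq_add_neg]

theorem ofTrees_toTrees_leftBracket {n : ℕ} (w : Fin n → V) :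
    ofTrees k V (toTrees k (FreeLie.leftBracket k V n w)) =
      (n : k) • FreeLie.leftBracket k V n w := by
  rcases n with _ | n
  · simp [FreeLie.leftBracket]
  induction n with
  | zero => rw [FreeLie.leftBracket_one, toTrees_of, ofTrees_vertex, Nat.cast_one, one_smul]
  | succ n ih =>
    rw [FreeLie.leftBracket_add_two, ofTrees_toTrees_lie, ih, toTrees_of, ofTrees_vertex, smul_lie]
    push_cast
    module

end OfTrees

section Isomorphism

variable {k : Type*} [CommRing k] [Algebra ℚ k] {V : Type*} [AddCommGroup V] [Module k V]

variable (k V) in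
/-- Division by the number of vertices. -/
def divDegree : Tr k V →ₗ[k] Tr k V :=
  DirectSum.lmap fun n => algebraMap ℚ k (n : ℚ)⁻¹ • LinearMap.id

theorem divDegree_decorate {α : Type*} [Fintype α] (T : RTree α) (w : α → V) :
    divDegree k V (Tr.decorate k T w) =
      algebraMap ℚ k (Fintype.card α : ℚ)⁻¹ • Tr.decorate k T w := by
  rw [Tr.decorate, Tr.of, divDegree, DirectSum.lmap_lof, LinearMap.smul_apply, map_smul,
    LinearMap.id_apply]

theorem divDegree_bracketSum {α : Type*} [Fintype α] (ρ : α → ℕ) (w : α → V) :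
    divDegree k V (bracketSum k ρ w) =
      algebraMap ℚ k (Fintype.card α : ℚ)⁻¹ • bracketSum k ρ w := by
  rw [bracketSum, map_sum, Finset.smul_sum]
  refine Finset.sum_congr rfl fun T _ => ?_
  rw [map_zsmul, divDegree_decorate, smul_comm]

attribute [local instance] Tr.lieRing Tr.lieAlgebra

theorem ofTrees_divDegree_toTrees (x : FreeLie k V) :
    ofTrees k V (divDegree k V (toTrees k x)) = x := by
  let F := ofTrees k V ∘ₗ divDegree k V ∘ₗ (toTrees k (V := V)).toLinearMap
  suffices h : F = LinearMap.id from LinearMap.congr_fun h x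
  refine LinearMap.ext_on FreeLie.span_leftBracket fun _ hx => ?_
  obtain ⟨n, w, rfl⟩ := Set.mem_iUnion.1 hx
  change ofTrees k V (divDegree k V (toTrees k _)) = _
  rw [toTrees_leftBracket, divDegree_bracketSum, Fintype.card_fin, ← toTrees_leftBracket, map_smul,
    ofTrees_toTrees_leftBracket, smul_smul]
  rcases eq_or_ne n 0 with rfl | hn
  · simp [FreeLie.leftBracket]
  · rw [← map_natCast (algebraMap ℚ k), ← map_mul, inv_mul_cancel₀ (Nat.cast_ne_zero.2 hn), map_one,
      one_smul, LinearMap.id_apply]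

theorem toTrees_injective : Function.Injective (toTrees k (V := V)) := fun x y h => by
  rw [← ofTrees_divDegree_toTrees x, h, ofTrees_divDegree_toTrees]

variable (k V) in
/-- The isomorphism between the free Lie algebra and the kernel of `δ`. -/
def freeLieEquiv : FreeLie k V ≃ₗ[k] LinearMap.ker (delta k V) :=
  LinearEquiv.ofBijective ((toTrees k (V := V)).toLinearMap.codRestrict _ delta_toTrees)
    ⟨fun _ _ h => toTrees_injective (congrArg Subtype.val h),
      fun y => by
        obtain ⟨x, hx⟩ := mem_range_of_delta_eq_zero (LinearMap.mem_ker.1 y.2)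
        exact ⟨x, Subtype.ext hx⟩⟩

end Isomorphism

end LieTrees

end

theorem mainTheorem2_general (k : Type u) [CommRing k] [Algebra ℚ k] :
    ∃ Φ : ∀ (V : Type v) [AddCommGroup V] [Module k V],
        LieTrees.FreeLie k V ≃ₗ[k] LinearMap.ker (LieTrees.delta k V),
      (∀ (V W : Type v) [AddCommGroup V] [Module k V] [AddCommGroup W] [Module k W]
        (f : V →ₗ[k] W) (x : LieTrees.FreeLie k V),
        (Φ W (LieTrees.FreeLie.map k f x) : LieTrees.Tr k W) =
          LieTrees.Tr.map k f (Φ V x : LieTrees.Tr k V)) ∧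
      (∀ (V : Type v) [AddCommGroup V] [Module k V] (x : V),
        (Φ V (LieTrees.FreeLie.of k x) : LieTrees.Tr k V) = LieTrees.Tr.vertex k x) ∧
      (∀ (V : Type v) [AddCommGroup V] [Module k V] (x y : LieTrees.FreeLie k V),
        (Φ V ⁅x, y⁆ : LieTrees.Tr k V) =
          LieTrees.star k V (Φ V x) (Φ V y) - LieTrees.star k V (Φ V y) (Φ V x)) :=
  ⟨fun V _ _ => LieTrees.freeLieEquiv k V,
    fun _ _ _ _ _ _ f x => LieTrees.toTrees_map f x,
    fun _ _ _ x => LieTrees.toTrees_of x,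
    fun _ _ _ x y => LieTrees.toTrees_lie x y⟩

theorem mainTheorem2 (k : Type u) [Field k] [CharZero k] :
    ∃ Φ : ∀ (V : Type v) [AddCommGroup V] [Module k V],
        LieTrees.FreeLie k V ≃ₗ[k] LinearMap.ker (LieTrees.delta k V),
      (∀ (V W : Type v) [AddCommGroup V] [Module k V] [AddCommGroup W] [Module k W]
        (f : V →ₗ[k] W) (x : LieTrees.FreeLie k V),
        (Φ W (LieTrees.FreeLie.map k f x) : LieTrees.Tr k W) =
          LieTrees.Tr.map k f (Φ V x : LieTrees.Tr k V)) ∧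
      (∀ (V : Type v) [AddCommGroup V] [Module k V] (x : V),
        (Φ V (LieTrees.FreeLie.of k x) : LieTrees.Tr k V) = LieTrees.Tr.vertex k x) ∧
      (∀ (V : Type v) [AddCommGroup V] [Module k V] (x y : LieTrees.FreeLie k V),
        (Φ V ⁅x, y⁆ : LieTrees.Tr k V) =
          LieTrees.star k V (Φ V x) (Φ V y) - LieTrees.star k V (Φ V y) (Φ V x)) :=
  mainTheorem2_general k
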